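/- Let $G$ be a finite group with $q=|G|$. Definitions: - A matroid $M'$ is a parallel (resp. series) extension of $M$ if some element $e$ of $M'$ lies in a circuit (resp. cocircuit) of $M'$ of cardinality $2$ and $M'\setminus e=M$ (resp. $M'/e=M$). A matroid is *series-parallel* if it is obtained from a single loop or a single coloop by a finite, possibly empty, sequence of series and parallel extensions. It is *quasi series-parallel* if all of its connected components are series-parallel (so the empty matroid is quasi series-parallel). It is *simple* if it has no circuit with at most two elements. - A *$G$-labeling* of a matroid $M$ on a ground set $E$ is a map $\phi\colon E\to G$; two $G$-labelings $\phi,\psi$ are *equivalent* if for every connected component $K$ of $M$ there is $g_K\in G$ with $\phi|_K=g_K\cdot\psi|_K$. A *$G$-labeled matroid* is a matroid together with an equivalence class of $G$-labelings of it. - Let $\mathcal C(n,k)$, $\mathcal S(n,k)$ and $\mathcal S_G(n,k)$ be the sets of, respectively, series-parallel matroids, simple quasi series-parallel matroids, and $G$-labeled simple quasi series-parallel matroids on $[n]=\{1,\dots,n\}$ of rank $k$. Let $$C(x,y)=\sum_{n\ge 1}\sum_{k=0}^n|\mathcal C(n,k)|\frac{x^n}{n!}y^k,\quad S(x,y)=\sum_{n\ge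 0}\sum_{k=0}^n|\mathcal S(n,k)|\frac{x^n}{n!}y^k,\quad S_G(x,y)=\sum_{n\ge 0}\sum_{k=0}^n|\mathcal S_G(n,k)|\frac{x^n}{n!}y^k,$$ and $A(x,y)=\exp(C(x,y))$, all regarded as formal power series in $x$ with coefficients in $\mathbb Q[y]$. For a power series $f$ in $x$ with constant coefficient $1$ and $r\in\mathbb Q$, put $f^{r}=\sum_{i\ge 0}\binom{r}{i}(f-1)^i$. **Proposition.** One has $$S_G(x,y)=\left(\frac{1}{qx+1}\,A\bigl(\log(qx+1),y\bigr)\right)^{1/q}=S(qx,y)^{1/q}.$$ -/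

import Mathlib

open scoped Polynomial PowerSeries Nat

namespace Matroid

/-- `M'` is a parallel extension of `M`: some element `e` of `M'` lies in a circuit of `M'` of
cardinality `2`, and deleting `e` gives `M`. -/
def IsParallelExtension {α : Type*} (M' M : Matroid α) : Prop :=
  ∃ e ∈ M'.E, (∃ C, M'.IsCircuit C ∧ e ∈ C ∧ C.encard = 2) ∧ M' ＼ {e} = M

/-- `M'` is a series extension of `M`: some element `e` of `M'` lies in a cocircuit of `M'` of
cardinality `2`, and contracting `e` gives `M`. -/
def IsSeriesExtension {α : Type*} (M' M : Matroid α) : Prop :=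
  ∃ e ∈ M'.E, (∃ K, M'.IsCocircuit K ∧ e ∈ K ∧ K.encard = 2) ∧ M' ／ {e} = M

/-- Series-parallel matroids: those obtained from a single loop or a single coloop by a finite,
possibly empty, sequence of series and parallel extensions. -/
inductive IsSeriesParallel {α : Type*} : Matroid α → Prop
  | loop (e : α) : IsSeriesParallel (loopyOn {e})
  | coloop (e : α) : IsSeriesParallel (freeOn {e})
  | parallel {M M' : Matroid α} (hM : IsSeriesParallel M) (h : IsParallelExtension M' M) :
      IsSeriesParallel M'
  | series {M M' : Matroid α} (hM : IsSeriesParallel M) (h : IsSeriesExtension M' M) :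
      IsSeriesParallel M'

/-- The connected component of `e` in `M`: the element `e` itself together with all elements that
lie in a common circuit with `e`. -/
def component {α : Type*} (M : Matroid α) (e : α) : Set α :=
  {f | f = e ∨ ∃ C, M.IsCircuit C ∧ e ∈ C ∧ f ∈ C}

/-- `K` is (the ground set of) a connected component of `M`. -/
def IsComponent {α : Type*} (M : Matroid α) (K : Set α) : Prop :=
  ∃ e ∈ M.E, K = M.component e

/-- A quasi series-parallel matroid: every connected component is series-parallel. -/
def IsQuasiSeriesParallel {α : Type*} (M : Matroid α) : Prop :=
  ∀ K, M.IsComponent K → (M ↾ K).IsSeriesParallel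

/-- A simple matroid: it has no circuit with at most two elements, that is, it has neither loops
nor pairs of distinct parallel elements. -/
def IsSimple {α : Type*} (M : Matroid α) : Prop :=
  ∀ C, M.IsCircuit C → 2 < C.encard

/-- Equivalence of `G`-labelings `M.E → G`: on each connected component the labelings differ by
left multiplication by an element of `G`. -/
def labelingSetoid {α : Type*} (G : Type*) [Group G] (M : Matroid α) : Setoid (M.E → G) where
  r a b := ∀ K, M.IsComponent K → ∃ g : G, ∀ e : M.E, (e : α) ∈ K → a e = g * b e
  iseqv :=
    { refl := fun a K _ => ⟨1, fun e _ => (one_mul (a e)).symm⟩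
      symm := fun h K hK => by
        obtain ⟨g, hg⟩ := h K hK
        exact ⟨g⁻¹, fun e he => by rw [hg e he, inv_mul_cancel_left]⟩
      trans := fun h h' K hK => by
        obtain ⟨g, hg⟩ := h K hK
        obtain ⟨g', hg'⟩ := h' K hK
        exact ⟨g * g', fun e he => by rw [hg e he, hg' e he, mul_assoc]⟩ }

/-- The set of series-parallel matroids on `[n]` of rank `k`. -/
def SP (n k : ℕ) : Type :=
  {M : Matroid (Fin n) // M.E = Set.univ ∧ M.IsSeriesParallel ∧ M.eRank = k}

/-- The set of simple quasi series-parallel matroids on `[n]` of rank `k`. -/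
def SimpleQSP (n k : ℕ) : Type :=
  {M : Matroid (Fin n) //
    M.E = Set.univ ∧ M.IsQuasiSeriesParallel ∧ M.IsSimple ∧ M.eRank = k}

/-- The set of `G`-labeled simple quasi series-parallel matroids on `[n]` of rank `k`: such a
matroid together with an equivalence class of `G`-labelings of it. -/
def LabeledSimpleQSP (G : Type*) [Group G] (n k : ℕ) : Type _ :=
  Σ M : SimpleQSP n k, Quotient (labelingSetoid G M.1)

end Matroid

/-- The bivariate generating function `∑ₙ ∑_{k ≤ n} a(n,k) xⁿ/n! yᵏ`, as a formal power series in
`x` whose coefficients are polynomials in `y`. -/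
noncomputable def bivariateEGF (a : ℕ → ℕ → ℕ) : ℚ[X]⟦X⟧ :=
  PowerSeries.mk fun n =>
    ∑ k ∈ Finset.range (n + 1), Polynomial.monomial k ((a n k : ℚ) / (n ! : ℚ))

/-- `C(x,y)`, counting series-parallel matroids. Its term for `n = 0` vanishes, because the ground
set of a series-parallel matroid is not empty. -/
noncomputable def genC : ℚ[X]⟦X⟧ :=
  bivariateEGF fun n k => Nat.card (Matroid.SP n k)

/-- `A(x,y) = exp(C(x,y))`. -/
noncomputable def genA : ℚ[X]⟦X⟧ :=
  (PowerSeries.exp ℚ[X]).subst genC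

/-- `S(x,y)`, counting simple quasi series-parallel matroids (the empty one included). -/
noncomputable def genS : ℚ[X]⟦X⟧ :=
  bivariateEGF fun n k => Nat.card (Matroid.SimpleQSP n k)

/-- `S_G(x,y)`, counting `G`-labeled simple quasi series-parallel matroids. -/
noncomputable def genSG (G : Type*) [Group G] : ℚ[X]⟦X⟧ :=
  bivariateEGF fun n k => Nat.card (Matroid.LabeledSimpleQSP G n k)

/-- The power `f ^ r = ∑ᵢ (r choose i) (f - 1)ⁱ` of a power series `f` with constant coefficient
`1`, for a rational exponent `r`. -/
noncomputable def ratPow (f : ℚ[X]⟦X⟧) (r : ℚ) : ℚ[X]⟦X⟧ :=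
  (PowerSeries.binomialSeries ℚ[X] r).subst (f - 1)

/-! Write D for `genSimpleSP`, the series of simple series-parallel matroids. Two facts give the
result: a relation between A and S, and a relation between S and S_G. Both rest on the fact that a
series-parallel matroid is connected (`IsSeriesParallel.isConn`), so that a quasi series-parallel
matroid is a set of series-parallel matroids on the blocks of a partition.

Labels. The exponential formula (`sum_matroidsOn_eq_factorial_mul_coeff`) gives S = exp(D). A
connected matroid on n ≥ 1 elements has qⁿ⁻¹ classes of labelings (`IsConn.card_mul_labelCount`),
and the number of classes is multiplicative over direct sums. Hence S_G = exp(D(qx)/q), which is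
S(qx)^(1/q) (`genSG_eq_ratPow`).

Loops and parallel classes. `genA_eq` says A = eˣ · S(eˣ - 1): loops form an arbitrary set, and each
element of a simple matroid is blown up to a nonempty parallel class. Substituting log(1 + qx) for x
gives A(log(1 + qx)) = (1 + qx) · S(qx), the other equality. The combinatorial input is that
deleting a loop or one element of a parallel pair neither creates nor destroys the quasi
series-parallel property. For parallel pairs this is not immediate, because the definition only
undoes the last extension; `IsSeriesParallel.deletionClosed_and_dual` proves it by induction on M
and its dual together. The count itself interpolates: `partialSimpleSum` requires simplicity only on
a subset U, and enlarging U by one element yields a recursion that the derivatives of S(eˣ - 1) also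
satisfy.

Identities of series involving exp, log and rational powers are obtained from uniqueness of
solutions of f · u' = g · u (`eq_of_mul_derivative_eq_mul`). -/

namespace Matroid

open Set

/-! ### Connected components as classes of the common-circuit relation -/

section Component

variable {α : Type*} {M N : Matroid α} {e f g : α} {C K : Set α}

lemma mem_component_self (M : Matroid α) (e : α) : e ∈ M.component e := Or.inl rfl

lemma IsCircuit.mem_component (hC : M.IsCircuit C) (he : e ∈ C) (hf : f ∈ C) :
    f ∈ M.component e := Or.inr ⟨C, hC, he, hf⟩

lemma mem_component_symm (h : f ∈ M.component e) : e ∈ M.component f := by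
  rcases h with rfl | ⟨C, hC, he, hf⟩
  · exact M.mem_component_self f
  · exact hC.mem_component hf he

lemma component_subset_ground (he : e ∈ M.E) : M.component e ⊆ M.E := by
  rintro f (rfl | ⟨C, hC, -, hf⟩)
  · exact he
  · exact hC.subset_ground hf

/-- Two intersecting circuits have a circuit through any two of their elements. -/
lemma IsCircuit.exists_isCircuit_of_inter_nonempty [Finite α] {C₁ C₂ : Set α}
    (h₁ : M.IsCircuit C₁) (h₂ : M.IsCircuit C₂) (hne : (C₁ ∩ C₂).Nonempty)
    (he : e ∈ C₁) (hg : g ∈ C₂) : ∃ C, M.IsCircuit C ∧ e ∈ C ∧ g ∈ C := by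
  induction hn : (C₁ ∪ C₂).ncard using Nat.strong_induction_on generalizing C₁ C₂ with
  | _ n ih =>
  by_cases heC : e ∈ C₂
  · exact ⟨C₂, h₂, heC, hg⟩
  by_cases hgC : g ∈ C₁
  · exact ⟨C₁, h₁, he, hgC⟩
  obtain ⟨f, hf₁, hf₂⟩ := hne
  obtain ⟨C₃, hC₃, h₃, he₃⟩ := h₁.strong_elimination h₂ hf₁ hf₂ he heC
  obtain ⟨C₄, hC₄, h₄, hg₄⟩ := h₂.strong_elimination h₁ hf₂ hf₁ hg hgC
  rw [union_comm] at hC₄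
  -- The induction applies to any intersecting circuits through `e` and `g` whose union is inside
  -- `C₁ ∪ C₂` and misses some element `a` of it.
  have step : ∀ {D₁ D₂ : Set α} {a}, M.IsCircuit D₁ → M.IsCircuit D₂ → (D₁ ∩ D₂).Nonempty →
      e ∈ D₁ → g ∈ D₂ → D₁ ∪ D₂ ⊆ C₁ ∪ C₂ → a ∈ C₁ ∪ C₂ → a ∉ D₁ ∪ D₂ →
      ∃ C, M.IsCircuit C ∧ e ∈ C ∧ g ∈ C := by
    intro D₁ D₂ a hD₁ hD₂ hD he' hg' hss ha ha'
    refine ih _ ?_ hD₁ hD₂ hD he' hg' rfl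
    rw [← hn]
    exact ncard_lt_ncard ⟨hss, fun h ↦ ha' (h ha)⟩ (toFinite _)
  have h32 : (C₃ ∩ C₂).Nonempty := by
    by_contra hcon
    have hss : C₃ ⊆ C₁ := fun x hx ↦ (hC₃ hx).1.resolve_right
      fun hx2 ↦ hcon ⟨x, hx, hx2⟩
    have := h₃.eq_of_subset_isCircuit h₁ hss
    exact (hC₃ (this ▸ hf₁)).2 rfl
  have h41 : (C₄ \ C₂).Nonempty := by
    by_contra hcon
    have hss : C₄ ⊆ C₂ := fun x hx ↦ by_contra fun hx2 ↦ hcon ⟨x, hx, hx2⟩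
    have := h₄.eq_of_subset_isCircuit h₂ hss
    exact (hC₄ (this ▸ hf₂)).2 rfl
  obtain ⟨a, ha4, ha2⟩ := h41
  -- If `a ∈ C₃`, then `C₃` and `C₄` meet and their union misses `f`; otherwise `C₃` and `C₂` meet
  -- and their union misses `a`.
  by_cases ha3 : a ∈ C₃
  · refine step h₃ h₄ ⟨a, ha3, ha4⟩ he₃ hg₄ ?_ (Or.inl hf₁) ?_
    · exact union_subset (fun x hx ↦ (hC₃ hx).1) (fun x hx ↦ (hC₄ hx).1)
    · rintro (h | h)
      exacts [(hC₃ h).2 rfl, (hC₄ h).2 rfl]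
  · refine step h₃ h₂ h32 he₃ hg ?_ (hC₄ ha4).1 ?_
    · exact union_subset (fun x hx ↦ (hC₃ hx).1) subset_union_right
    · rintro (h | h)
      exacts [ha3 h, ha2 h]

lemma mem_component_trans [Finite α] (h : f ∈ M.component e) (h' : g ∈ M.component f) :
    g ∈ M.component e := by
  rcases h with rfl | ⟨C, hC, he, hf⟩
  · exact h'
  rcases h' with rfl | ⟨D, hD, hf', hg⟩
  · exact hC.mem_component he hf
  exact Or.inr (hC.exists_isCircuit_of_inter_nonempty hD ⟨f, hf, hf'⟩ he hg)

lemma component_eq_of_mem [Finite α] (h : f ∈ M.component e) :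
    M.component f = M.component e :=
  Subset.antisymm (fun _ hx ↦ mem_component_trans h hx)
    fun _ hx ↦ mem_component_trans (mem_component_symm h) hx

lemma IsCircuit.subset_component [Finite α] (hC : M.IsCircuit C) (hf : f ∈ C)
    (h : f ∈ M.component e) : C ⊆ M.component e :=
  fun _ hx ↦ mem_component_trans h (hC.mem_component hf hx)

/-- Every two elements of the matroid lie in a common component. -/
def IsConn (M : Matroid α) : Prop := ∀ e ∈ M.E, M.component e = M.E

lemma isConn_of_forall_mem [Finite α] (he : e ∈ M.E)
    (h : ∀ f ∈ M.E, f ∈ M.component e) : M.IsConn := fun f hf ↦ by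
  rw [component_eq_of_mem (h f hf)]
  exact (component_subset_ground he).antisymm h

lemma restrict_component_eq (hK : K ⊆ M.E) (he : M.component e ⊆ K) :
    (M ↾ K).component e = M.component e := by
  ext f
  constructor
  · rintro (rfl | ⟨C, hC, he', hf⟩)
    · exact M.mem_component_self _
    · exact ((restrict_isCircuit_iff hK).1 hC).1.mem_component he' hf
  · rintro (rfl | ⟨C, hC, he', hf⟩)
    · exact mem_component_self _ _
    · exact ((restrict_isCircuit_iff hK).2
        ⟨hC, fun x hx ↦ he (hC.mem_component he' hx)⟩).mem_component he' hf

lemma isConn_restrict_component [Finite α] (he : e ∈ M.E) : (M ↾ M.component e).IsConn := by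
  refine isConn_of_forall_mem (e := e) (M.mem_component_self e) fun f hf ↦ ?_
  rwa [restrict_component_eq (component_subset_ground he) Subset.rfl]

lemma IsConn.isQuasiSeriesParallel_iff (hM : M.IsConn) (hne : M.E.Nonempty) :
    M.IsQuasiSeriesParallel ↔ M.IsSeriesParallel := by
  constructor
  · obtain ⟨e, he⟩ := hne
    intro h
    simpa [hM e he] using h _ ⟨e, he, rfl⟩
  · rintro h _ ⟨e, he, rfl⟩
    simpa [hM e he] using h

end Component

/-! ### Direct sums and splitting off a component -/

section DisjointSum

variable {α : Type*} {M N : Matroid α} {e : α} {C K X : Set α}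

lemma disjointSum_restrict_left (h : Disjoint M.E N.E) (hX : X ⊆ M.E) :
    (M.disjointSum N h) ↾ X = M ↾ X := by
  refine ext_indep rfl fun I (hI : I ⊆ X) ↦ ?_
  have h1 : I ∩ M.E = I := inter_eq_self_of_subset_left (hI.trans hX)
  have h2 : I ∩ N.E = ∅ := (h.mono_left (hI.trans hX)).inter_eq
  simp only [restrict_indep_iff, disjointSum_indep_iff, h1, h2, empty_indep, true_and,
    and_congr_left_iff, and_iff_left_iff_imp]
  exact fun _ _ ↦ (hI.trans hX).trans subset_union_left

lemma disjointSum_restrict_right (h : Disjoint M.E N.E) (hX : X ⊆ N.E) :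
    (M.disjointSum N h) ↾ X = N ↾ X := by
  rw [disjointSum_comm, disjointSum_restrict_left _ hX]

/-- A set dependent in the sum is already dependent on one side, so a circuit contains, and by
minimality equals, a circuit of that summand. -/
lemma disjointSum_isCircuit_iff (h : Disjoint M.E N.E) :
    (M.disjointSum N h).IsCircuit C ↔ M.IsCircuit C ∨ N.IsCircuit C := by
  have hl : ∀ {D}, M.IsCircuit D ↔ (M.disjointSum N h).IsCircuit D ∧ D ⊆ M.E := fun {D} ↦ by
    rw [← restrict_isCircuit_iff (by simp), disjointSum_restrict_left h Subset.rfl,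
      restrict_ground_eq_self]
  have hr : ∀ {D}, N.IsCircuit D ↔ (M.disjointSum N h).IsCircuit D ∧ D ⊆ N.E := fun {D} ↦ by
    rw [← restrict_isCircuit_iff (by simp), disjointSum_restrict_right h Subset.rfl,
      restrict_ground_eq_self]
  refine ⟨fun hC ↦ ?_, fun hC ↦ hC.elim (fun h' ↦ (hl.1 h').1) (fun h' ↦ (hr.1 h').1)⟩
  have hCE : C ⊆ M.E ∪ N.E := by simpa using hC.subset_ground
  have hd := hC.not_indep
  rw [disjointSum_indep_iff] at hd
  by_cases h1 : M.Indep (C ∩ M.E)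
  · have h2 : ¬ N.Indep (C ∩ N.E) := fun h2 ↦ hd ⟨h1, h2, hCE⟩
    obtain ⟨D, hD, hDc⟩ := ((not_indep_iff inter_subset_right).1 h2).exists_isCircuit_subset
    have := (hr.1 hDc).1.eq_of_subset_isCircuit hC (hD.trans inter_subset_left)
    exact Or.inr (this ▸ hDc)
  · obtain ⟨D, hD, hDc⟩ := ((not_indep_iff inter_subset_right).1 h1).exists_isCircuit_subset
    have := (hl.1 hDc).1.eq_of_subset_isCircuit hC (hD.trans inter_subset_left)
    exact Or.inl (this ▸ hDc)

lemma disjointSum_component_left (h : Disjoint M.E N.E) (he : e ∈ M.E) :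
    (M.disjointSum N h).component e = M.component e := by
  ext f
  simp only [component, disjointSum_isCircuit_iff, mem_ofPred_eq]
  refine or_congr_right ⟨?_, ?_⟩
  · rintro ⟨C, hC | hC, heC, hf⟩
    · exact ⟨C, hC, heC, hf⟩
    · exact (h.notMem_of_mem_left he (hC.subset_ground heC)).elim
  · rintro ⟨C, hC, heC, hf⟩
    exact ⟨C, Or.inl hC, heC, hf⟩

lemma disjointSum_component_right (h : Disjoint M.E N.E) (he : e ∈ N.E) :
    (M.disjointSum N h).component e = N.component e := by
  rw [disjointSum_comm, disjointSum_component_left _ he]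

lemma disjointSum_isComponent_iff (h : Disjoint M.E N.E) :
    (M.disjointSum N h).IsComponent K ↔ M.IsComponent K ∨ N.IsComponent K := by
  constructor
  · rintro ⟨e, he, rfl⟩
    rw [disjointSum_ground_eq] at he
    rcases he with he | he
    · exact Or.inl ⟨e, he, disjointSum_component_left h he⟩
    · exact Or.inr ⟨e, he, disjointSum_component_right h he⟩
  · rintro (⟨e, he, rfl⟩ | ⟨e, he, rfl⟩)
    · exact ⟨e, by simp [he], (disjointSum_component_left h he).symm⟩
    · exact ⟨e, by simp [he], (disjointSum_component_right h he).symm⟩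

lemma IsComponent.subset_ground (hK : M.IsComponent K) : K ⊆ M.E := by
  obtain ⟨e, he, rfl⟩ := hK
  exact component_subset_ground he

lemma disjointSum_isQuasiSeriesParallel_iff (h : Disjoint M.E N.E) :
    (M.disjointSum N h).IsQuasiSeriesParallel ↔
      M.IsQuasiSeriesParallel ∧ N.IsQuasiSeriesParallel := by
  simp only [IsQuasiSeriesParallel, disjointSum_isComponent_iff, or_imp, forall_and]
  refine and_congr (forall₂_congr fun K hK ↦ ?_) (forall₂_congr fun K hK ↦ ?_)
  · rw [disjointSum_restrict_left h hK.subset_ground]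
  · rw [disjointSum_restrict_right h hK.subset_ground]

lemma disjointSum_isSimple_iff (h : Disjoint M.E N.E) :
    (M.disjointSum N h).IsSimple ↔ M.IsSimple ∧ N.IsSimple := by
  simp only [IsSimple, disjointSum_isCircuit_iff, or_imp, forall_and]

lemma eRank_disjointSum (h : Disjoint M.E N.E) :
    (M.disjointSum N h).eRank = M.eRank + N.eRank := by
  obtain ⟨B, hB⟩ := (M.disjointSum N h).exists_isBase
  rw [← hB.encard_eq_eRank]
  rw [disjointSum_isBase_iff] at hB
  rw [← hB.1.encard_eq_eRank, ← hB.2.1.encard_eq_eRank,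
    ← encard_union_eq (h.mono inter_subset_right inter_subset_right), ← inter_union_distrib_left,
    inter_eq_self_of_subset_left hB.2.2]

/-- A matroid is the direct sum of the component of an element and the remaining part. -/
lemma disjointSum_component_compl [Finite α] (he : e ∈ M.E)
    (h : Disjoint (M ↾ M.component e).E (M ↾ (M.E \ M.component e)).E) :
    (M ↾ M.component e).disjointSum (M ↾ (M.E \ M.component e)) h = M := by
  have hK := component_subset_ground he
  refine ext_indep (by simp [union_sdiff_cancel hK]) fun I hI ↦ ?_
  simp only [disjointSum_ground_eq, restrict_ground_eq, union_sdiff_cancel hK] at hI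
  simp only [disjointSum_indep_iff, restrict_indep_iff, restrict_ground_eq, inter_subset_right,
    and_true, union_sdiff_cancel hK, hI]
  refine ⟨fun ⟨h1, h2⟩ ↦ ?_, fun h ↦ ⟨h.subset inter_subset_left, h.subset inter_subset_left⟩⟩
  rw [indep_iff_forall_subset_not_isCircuit]
  intro C hCI hC
  obtain ⟨x, hx⟩ := hC.nonempty
  by_cases hxK : x ∈ M.component e
  · exact hC.not_indep (h1.subset (subset_inter hCI (hC.subset_component hx hxK)))
  · refine hC.not_indep (h2.subset (subset_inter hCI fun y hy ↦ ⟨hI (hCI hy), fun hyK ↦ hxK ?_⟩))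
    exact hC.subset_component hy hyK hx

lemma isQuasiSeriesParallel_iff_of_mem_ground [Finite α] (he : e ∈ M.E) :
    M.IsQuasiSeriesParallel ↔ (M ↾ M.component e).IsSeriesParallel ∧
      (M ↾ (M.E \ M.component e)).IsQuasiSeriesParallel := by
  have h : Disjoint (M ↾ M.component e).E (M ↾ (M.E \ M.component e)).E := disjoint_sdiff_right
  conv_lhs => rw [← disjointSum_component_compl he h]
  rw [disjointSum_isQuasiSeriesParallel_iff,
    (isConn_restrict_component he).isQuasiSeriesParallel_iff ⟨e, M.mem_component_self e⟩]

end DisjointSum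

/-! ### Series-parallel matroids: duality, connectedness, relabeling -/

section SeriesParallel

variable {α : Type*} {M N : Matroid α} {e f : α} {C K X : Set α}

lemma IsSeriesParallel.ground_nonempty (h : M.IsSeriesParallel) : M.E.Nonempty := by
  cases h with
  | loop e => exact ⟨e, rfl⟩
  | coloop e => exact ⟨e, rfl⟩
  | parallel hM h => obtain ⟨e, he, -⟩ := h; exact ⟨e, he⟩
  | series hM h => obtain ⟨e, he, -⟩ := h; exact ⟨e, he⟩

lemma isParallelExtension_iff {M' M : Matroid α} :
    IsParallelExtension M' M ↔ ∃ a b, a ≠ b ∧ M'.IsCircuit {a, b} ∧ M' ＼ {a} = M := by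
  constructor
  · rintro ⟨a, -, ⟨C, hC, haC, hC2⟩, rfl⟩
    obtain ⟨x, y, hxy, rfl⟩ := encard_eq_two.1 hC2
    rcases haC with rfl | rfl
    · exact ⟨_, y, hxy, hC, rfl⟩
    · exact ⟨_, x, hxy.symm, pair_comm _ _ ▸ hC, rfl⟩
  · rintro ⟨a, b, hab, hC, rfl⟩
    exact ⟨a, hC.subset_ground (by simp), ⟨_, hC, by simp, encard_pair hab⟩, rfl⟩

lemma isSeriesExtension_iff {M' M : Matroid α} :
    IsSeriesExtension M' M ↔ ∃ a b, a ≠ b ∧ M'.IsCocircuit {a, b} ∧ M' ／ {a} = M := by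
  constructor
  · rintro ⟨a, -, ⟨C, hC, haC, hC2⟩, rfl⟩
    obtain ⟨x, y, hxy, rfl⟩ := encard_eq_two.1 hC2
    rcases haC with rfl | rfl
    · exact ⟨_, y, hxy, hC, rfl⟩
    · exact ⟨_, x, hxy.symm, pair_comm _ _ ▸ hC, rfl⟩
  · rintro ⟨a, b, hab, hC, rfl⟩
    exact ⟨a, hC.subset_ground (by simp), ⟨_, hC, by simp, encard_pair hab⟩, rfl⟩

lemma dual_isSeriesExtension_iff {M' M : Matroid α} :
    IsSeriesExtension M'✶ M✶ ↔ IsParallelExtension M' M := by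
  simp only [isSeriesExtension_iff, isParallelExtension_iff, dual_isCocircuit_iff, ← dual_delete,
    dual_inj]

lemma dual_isParallelExtension_iff {M' M : Matroid α} :
    IsParallelExtension M'✶ M✶ ↔ IsSeriesExtension M' M := by
  rw [← dual_isSeriesExtension_iff, dual_dual, dual_dual]

lemma IsSeriesParallel.dual (h : M.IsSeriesParallel) : M✶.IsSeriesParallel := by
  induction h with
  | loop e => rw [loopyOn_dual_eq]; exact .coloop e
  | coloop e => rw [freeOn_dual_eq]; exact .loop e
  | parallel hM h ih => exact .series ih (dual_isSeriesExtension_iff.2 h)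
  | series hM h ih => exact .parallel ih (dual_isParallelExtension_iff.2 h)

lemma isSeriesParallel_dual_iff : M✶.IsSeriesParallel ↔ M.IsSeriesParallel :=
  ⟨fun h ↦ by simpa using h.dual, IsSeriesParallel.dual⟩

lemma IsParallelExtension.isConn [Finite α] (h : IsParallelExtension M N) (hN : N.IsConn) :
    M.IsConn := by
  obtain ⟨a, b, hab, hC, rfl⟩ := isParallelExtension_iff.1 h
  have hb : b ∈ M.E := hC.subset_ground (by simp)
  refine isConn_of_forall_mem hb fun f hf ↦ ?_
  by_cases hfa : f = a
  · exact hfa ▸ hC.mem_component (by simp) (by simp)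
  have hf' : f ∈ (M ＼ {a}).component b := by
    rw [hN b ⟨hb, hab.symm⟩]
    exact ⟨hf, hfa⟩
  rcases hf' with rfl | ⟨C, hC, h1, h2⟩
  · exact M.mem_component_self _
  · exact hC.of_delete.mem_component h1 h2

/-- The element `a` is no coloop, as `{a}` would be a cocircuit strictly inside `{a, b}`, and no
loop, as it lies in a cocircuit. So a circuit joins it to some `g ≠ a`. Circuits of the contraction
extend to circuits of `M`, which joins every other element to `g`. -/
lemma IsSeriesExtension.isConn [Finite α] (h : IsSeriesExtension M N) (hN : N.IsConn) :
    M.IsConn := by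
  obtain ⟨a, b, hab, hC, rfl⟩ := isSeriesExtension_iff.1 h
  have ha : a ∈ M.E := hC.subset_ground (by simp)
  have hnc : ¬ M.IsColoop a := fun hc ↦ by
    have := hc.isCocircuit.eq_of_subset_isCircuit hC (by simp)
    have hb : b ∈ ({a} : Set α) := this ▸ (by simp)
    exact hab hb.symm
  obtain ⟨C, hCc, haC⟩ := exists_mem_isCircuit_of_not_isColoop ha hnc
  have hnt : C.Nontrivial := by
    by_contra hnt
    have hCa := (not_nontrivial_iff.1 hnt).eq_singleton_of_mem haC
    rw [hCa, singleton_isCircuit] at hCc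
    exact (hC.isNonloop_of_mem (by simp : a ∈ _)).not_isLoop hCc
  obtain ⟨g, hg, hga⟩ := hnt.exists_ne a
  have hgE := hCc.subset_ground hg
  refine isConn_of_forall_mem hgE fun f hf ↦ ?_
  by_cases hfa : f = a
  · exact hCc.mem_component hg (hfa ▸ haC)
  have hf' : f ∈ (M ／ {a}).component g := by
    rw [hN g ⟨hgE, hga⟩]
    exact ⟨hf, hfa⟩
  rcases hf' with rfl | ⟨D, hD, h1, h2⟩
  · exact M.mem_component_self _
  · obtain ⟨D', hD', hss, -⟩ := hD.exists_subset_isCircuit_of_contract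
    exact hD'.mem_component (hss h1) (hss h2)

lemma IsSeriesParallel.isConn [Finite α] (h : M.IsSeriesParallel) : M.IsConn := by
  induction h with
  | loop e => exact isConn_of_forall_mem (e := e) rfl fun f hf ↦ Or.inl hf
  | coloop e => exact isConn_of_forall_mem (e := e) rfl fun f hf ↦ Or.inl hf
  | parallel hM h ih => exact h.isConn ih
  | series hM h ih => exact h.isConn ih

lemma map_isCircuit_image_iff {β : Type*} {f : α → β} (hf : InjOn f M.E) (hC : C ⊆ M.E) :
    (M.map f hf).IsCircuit (f '' C) ↔ M.IsCircuit C := by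
  have hdep : ∀ {D}, D ⊆ M.E → ((M.map f hf).Dep (f '' D) ↔ M.Dep D) := fun {D} hD ↦ by
    rw [Dep, map_image_indep_iff hD, map_ground, Dep, and_iff_left (image_mono hD),
      and_iff_left hD]
  rw [isCircuit_iff, isCircuit_iff, hdep hC, and_congr_right_iff]
  intro _
  constructor
  · intro h D hD hDC
    have := h ((hdep hD.subset_ground).2 hD) (image_mono hDC)
    exact (hf.image_eq_image_iff hD.subset_ground hC).1 this
  · intro h D hD hDC
    obtain ⟨D, hDC', rfl⟩ := subset_image_iff.1 hDC
    rw [h ((hdep (hDC'.trans hC)).1 hD) hDC']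

lemma map_isCircuit_iff {β : Type*} {f : α → β} (hf : InjOn f M.E) {C : Set β} :
    (M.map f hf).IsCircuit C ↔ ∃ C₀, M.IsCircuit C₀ ∧ C = f '' C₀ := by
  constructor
  · intro hC
    obtain ⟨C₀, hC₀, rfl⟩ := subset_image_iff.1 hC.subset_ground
    exact ⟨C₀, (map_isCircuit_image_iff hf hC₀).1 hC, rfl⟩
  · rintro ⟨C₀, hC₀, rfl⟩
    exact (map_isCircuit_image_iff hf hC₀.subset_ground).2 hC₀

lemma map_delete {β : Type*} {f : α → β} (hf : InjOn f M.E) (he : e ∈ M.E) :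
    (M.map f hf) ＼ {f e} = (M ＼ {e}).map f (hf.mono sdiff_subset) := by
  refine ext_indep ?_ fun I hI ↦ ?_
  · simp only [delete_ground, map_ground]
    rw [hf.image_sdiff, inter_eq_self_of_subset_right (singleton_subset_iff.2 he),
      image_singleton]
  simp only [deleteElem_indep_iff, map_indep_iff]
  constructor
  · rintro ⟨⟨J, hJ, rfl⟩, heJ⟩
    exact ⟨J, ⟨hJ, fun h ↦ heJ (mem_image_of_mem f h)⟩, rfl⟩
  · rintro ⟨J, ⟨hJ, heJ⟩, rfl⟩
    refine ⟨⟨J, hJ, rfl⟩, ?_⟩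
    rwa [hf.mem_image_iff hJ.subset_ground he]

lemma IsParallelExtension.map {β : Type*} {f : α → β} (h : IsParallelExtension M N)
    (hf : InjOn f M.E) : ∃ hf', IsParallelExtension (M.map f hf) (N.map f hf') := by
  obtain ⟨a, b, hab, hC, rfl⟩ := isParallelExtension_iff.1 h
  have hs := hC.subset_ground
  have ha : a ∈ M.E := hs (by simp)
  have hb : b ∈ M.E := hs (by simp)
  refine ⟨hf.mono sdiff_subset, isParallelExtension_iff.2 ⟨f a, f b, hf.ne ha hb hab, ?_,
    map_delete hf ha⟩⟩
  rw [← image_pair]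
  exact (map_isCircuit_image_iff hf hs).2 hC

/-- Injectivity on the ground set is the right generality: `IsCircuit.isSeriesParallel_delete_swap`
uses a map that merges two elements of the type, only one of them in the ground set. The series step
is the parallel step for the dual. -/
lemma IsSeriesParallel.map {β : Type*} {f : α → β} (h : M.IsSeriesParallel)
    (hf : InjOn f M.E) : (M.map f hf).IsSeriesParallel := by
  induction h with
  | loop e => rw [map_loopyOn, image_singleton]; exact .loop _
  | coloop e => rw [map_freeOn, image_singleton]; exact .coloop _
  | parallel hM h ih =>
    obtain ⟨hf', h'⟩ := h.map hf
    exact .parallel (ih hf') h'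
  | series hM h ih =>
    obtain ⟨hf', h'⟩ := (dual_isParallelExtension_iff.2 h).map hf
    refine .series (ih hf') (dual_isParallelExtension_iff.1 ?_)
    convert h' using 1 <;> exact map_dual

lemma map_isSeriesParallel_iff {β : Type*} {f : α → β} (hf : f.Injective) :
    (M.map f hf.injOn).IsSeriesParallel ↔ M.IsSeriesParallel := by
  refine ⟨fun h ↦ ?_, fun h ↦ h.map _⟩
  obtain ⟨-, e, he, -⟩ := h.ground_nonempty
  have : Nonempty α := ⟨e⟩
  have hl := Function.leftInverse_invFun hf
  have hinj : InjOn (Function.invFun f) (M.map f hf.injOn).E := by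
    rintro _ ⟨x, hx, rfl⟩ _ ⟨y, hy, rfl⟩ hxy
    rw [hl x, hl y] at hxy
    rw [hxy]
  have := h.map hinj
  convert this
  refine ext_indep ?_ fun I hI ↦ ?_
  · simp [image_image, hl _]
  · simp only [map_indep_iff]
    constructor
    · intro h
      exact ⟨f '' I, ⟨I, h, rfl⟩, by simp [image_image, hl _]⟩
    · rintro ⟨_, ⟨J, hJ, rfl⟩, rfl⟩
      simpa [image_image, hl _] using hJ

lemma map_isSimple_iff {β : Type*} {f : α → β} (hf : InjOn f M.E) :
    (M.map f hf).IsSimple ↔ M.IsSimple := by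
  simp only [IsSimple, map_isCircuit_iff]
  constructor
  · intro h C hC
    simpa [(hf.mono hC.subset_ground).encard_image] using h _ ⟨C, hC, rfl⟩
  · rintro h _ ⟨C, hC, rfl⟩
    rw [(hf.mono hC.subset_ground).encard_image]
    exact h C hC

end SeriesParallel

end Matroid

namespace Matroid

open Set

/-! ### Removing and restoring parallel elements and loops -/

section Parallel

variable {α : Type*} {M N : Matroid α} {a b e f u x : α} {C K X I : Set α}

lemma IsCircuit.isNonloop_left (h : M.IsCircuit {a, b}) (hab : a ≠ b) : M.IsNonloop a :=
  h.isNonloop_of_mem (nontrivial_pair hab) (by simp)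

lemma IsCircuit.isNonloop_right (h : M.IsCircuit {a, b}) (hab : a ≠ b) : M.IsNonloop b :=
  h.isNonloop_of_mem (nontrivial_pair hab) (by simp)

lemma IsCircuit.closure_pair_eq (h : M.IsCircuit {a, b}) (hab : a ≠ b) :
    M.closure {a} = M.closure {b} :=
  ((h.isNonloop_left hab).closure_eq_closure_iff_isCircuit_of_ne hab).2 h

lemma IsCircuit.pair_trans (h : M.IsCircuit {a, b}) (h' : M.IsCircuit {b, e}) (hab : a ≠ b)
    (hbe : b ≠ e) (hae : a ≠ e) : M.IsCircuit {a, e} :=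
  ((h.isNonloop_left hab).closure_eq_closure_iff_isCircuit_of_ne hae).1
    ((h.closure_pair_eq hab).trans (h'.closure_pair_eq hbe))

lemma Dep.isCircuit_pair (h : M.Dep {a, b}) (ha : ¬ M.IsLoop a) (hb : ¬ M.IsLoop b) :
    M.IsCircuit {a, b} := by
  obtain ⟨C, hC, hCc⟩ := h.exists_isCircuit_subset
  rcases subset_pair_iff_eq.1 hC with rfl | rfl | rfl | rfl
  · exact (hCc.nonempty.ne_empty rfl).elim
  · exact (ha (singleton_isCircuit.1 hCc)).elim
  · exact (hb (singleton_isCircuit.1 hCc)).elim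
  · exact hCc

lemma IsCircuit.mem_closure_iff_of_pair (h : M.IsCircuit {a, b}) (hab : a ≠ b) :
    a ∈ M.closure X ↔ b ∈ M.closure X := by
  have key : ∀ {c d}, M.IsCircuit {c, d} → c ≠ d → c ∈ M.closure X → d ∈ M.closure X := by
    intro c d h hcd hc
    have hd : d ∈ M.closure {c} := by
      rw [h.closure_pair_eq hcd]
      exact M.mem_closure_of_mem' rfl (h.subset_ground (by simp))
    exact M.closure_subset_closure_of_subset_closure (singleton_subset_iff.2 hc) hd
  exact ⟨key h hab, key (pair_comm a b ▸ h) hab.symm⟩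

lemma IsCircuit.insert_indep_iff_of_pair (h : M.IsCircuit {a, b}) (hab : a ≠ b) (ha : a ∉ I)
    (hb : b ∉ I) : M.Indep (insert a I) ↔ M.Indep (insert b I) := by
  have hs := h.subset_ground
  have haE : a ∈ M.E := hs (by simp)
  have hbE : b ∈ M.E := hs (by simp)
  by_cases hI : M.Indep I
  · rw [hI.insert_indep_iff_of_notMem ha, hI.insert_indep_iff_of_notMem hb]
    simp only [mem_sdiff, haE, hbE, true_and, h.mem_closure_iff_of_pair hab]
  · exact iff_of_false (fun h ↦ hI (h.subset (subset_insert _ _)))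
      (fun h ↦ hI (h.subset (subset_insert _ _)))

lemma image_update_id_of_notMem [DecidableEq α] (hx : x ∉ I) :
    Function.update id x u '' I = I := by
  conv_rhs => rw [← image_id I]
  refine image_congr fun y hy ↦ ?_
  rw [Function.update_of_ne]
  rintro rfl
  exact hx hy

lemma image_update_id_insert [DecidableEq α] (hx : x ∉ I) :
    Function.update id x u '' (insert x I) = insert u I := by
  rw [image_insert_eq, image_update_id_of_notMem hx, Function.update_self]

lemma preimage_update_id_sdiff [DecidableEq α] (hu : u ∈ X) (hxu : x ≠ u) :
    Function.update id x u ⁻¹' (X \ {x}) = insert x X := by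
  ext y
  by_cases hy : y = x
  · subst hy; simp [hu, hxu.symm]
  · simp [hy]

/-- If `x` and `u` are parallel, then the matroid is recovered from the deletion of `x`. -/
lemma IsCircuit.comap_delete_eq [DecidableEq α] (h : M.IsCircuit {x, u}) (hxu : x ≠ u) :
    (M ＼ {x}).comap (Function.update id x u) = M := by
  have hs := h.subset_ground
  have hx : x ∈ M.E := hs (by simp)
  have hu : u ∈ M.E := hs (by simp)
  refine ext_indep ?_ fun I hI ↦ ?_
  · rw [comap_ground_eq, delete_ground, preimage_update_id_sdiff hu hxu, insert_eq_of_mem hx]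
  rw [comap_indep_iff]
  by_cases hxI : x ∈ I
  · obtain ⟨J, rfl, hxJ⟩ : ∃ J, I = insert x J ∧ x ∉ J := ⟨I \ {x}, by simp [hxI], by simp⟩
    rw [image_update_id_insert hxJ]
    by_cases huJ : u ∈ J
    · refine iff_of_false (fun hc ↦ hxu (hc.2 (by simp) (by simp [huJ]) ?_)) fun hc ↦
        h.not_indep (hc.subset ?_)
      · rw [Function.update_self, Function.update_of_ne hxu.symm, id]
      · exact insert_subset_insert (singleton_subset_iff.2 huJ)
    · rw [deleteElem_indep_iff, h.insert_indep_iff_of_pair hxu hxJ huJ, and_assoc,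
        and_iff_left_iff_imp]
      intro _
      refine ⟨by simp [hxu, hxJ], ?_⟩
      have hJ : EqOn (Function.update id x u) id J := fun y hy ↦
        Function.update_of_ne (by rintro rfl; exact hxJ hy) _ _
      rw [injOn_insert hxJ, hJ.injOn_iff, hJ.image_eq, image_id, Function.update_self]
      exact ⟨injOn_id J, huJ⟩
  · have hJ : EqOn (Function.update id x u) id I := fun y hy ↦
      Function.update_of_ne (by rintro rfl; exact hxI hy) _ _
    rw [image_update_id_of_notMem hxI, deleteElem_indep_iff, hJ.injOn_iff]
    simp [hxI, injOn_id]

lemma comap_update_ground [DecidableEq α] (hx : x ∉ N.E) (hu : u ∈ N.E) :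
    (N.comap (Function.update id x u)).E = insert x N.E := by
  rw [comap_ground_eq, ← preimage_update_id_sdiff hu (by rintro rfl; exact hx hu),
    sdiff_singleton_eq_self hx]

/-- Pulling back along the map that sends `x` to `u` and fixes the rest adds `x` as a copy of `u`.
Together with `IsCircuit.comap_delete_eq` this makes deletion of `x` a bijection when `u` is a
nonloop. -/
lemma comap_update_delete [DecidableEq α] (hx : x ∉ N.E) (hu : u ∈ N.E) :
    (N.comap (Function.update id x u)) ＼ {x} = N := by
  refine ext_indep ?_ fun I hI ↦ ?_
  · rw [delete_ground, comap_update_ground hx hu]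
    simp [hx]
  · have hxI : x ∉ I := fun h ↦ (hI h).2 rfl
    have hJ : EqOn (Function.update id x u) id I := fun y hy ↦
      Function.update_of_ne (by rintro rfl; exact hxI hy) _ _
    rw [deleteElem_indep_iff, comap_indep_iff, image_update_id_of_notMem hxI, hJ.injOn_iff]
    simp [hxI, injOn_id]

lemma comap_update_isCircuit [DecidableEq α] (hx : x ∉ N.E) (hu : N.IsNonloop u) :
    (N.comap (Function.update id x u)).IsCircuit {x, u} := by
  have hxu : x ≠ u := by rintro rfl; exact hx hu.mem_ground
  refine Dep.isCircuit_pair ⟨?_, ?_⟩ ?_ ?_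
  · rw [comap_indep_iff]
    refine fun h ↦ hxu (h.2 (by simp) (by simp) ?_)
    rw [Function.update_self, Function.update_of_ne hxu.symm, id]
  · rw [comap_update_ground hx hu.mem_ground]
    rintro y (rfl | rfl)
    exacts [mem_insert _ _, mem_insert_of_mem _ hu.mem_ground]
  · rw [comap_isLoop_iff, Function.update_self]
    exact hu.not_isLoop
  · rw [comap_isLoop_iff, Function.update_of_ne hxu.symm]
    exact hu.not_isLoop

lemma IsCircuit.eRank_delete_eq (h : M.IsCircuit {x, u}) (hxu : x ≠ u) :
    (M ＼ {x}).eRank = M.eRank := by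
  classical
  have hs := h.subset_ground
  have hx : x ∈ M.E := hs (by simp)
  have hu : u ∈ M.E := hs (by simp)
  have h1 := eRk_comap (M ＼ {x}) (f := Function.update id x u) M.E
  rw [h.comap_delete_eq hxu, eRk_ground] at h1
  rw [h1, ← eRk_ground, delete_ground]
  congr 1
  obtain ⟨J, hJ, hxJ⟩ : ∃ J, M.E = insert x J ∧ x ∉ J := ⟨M.E \ {x}, by simp [hx], by simp⟩
  rw [hJ, image_update_id_insert hxJ]
  have : u ∈ J := by
    rw [hJ] at hu
    exact hu.resolve_left hxu.symm
  simp [this, hxJ]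

/-- Deleting either element of a parallel pair gives isomorphic matroids. -/
lemma IsCircuit.isSeriesParallel_delete_swap (h : M.IsCircuit {a, b}) (hab : a ≠ b)
    (ha : (M ＼ {a}).IsSeriesParallel) : (M ＼ {b}).IsSeriesParallel := by
  classical
  have hs := h.subset_ground
  have haE : a ∈ M.E := hs (by simp)
  have hbE : b ∈ M.E := hs (by simp)
  have hne : ∀ {J : Set α}, b ∉ J → EqOn (Function.update id b a) id J := fun hJ y hy ↦
    Function.update_of_ne (by rintro rfl; exact hJ hy) _ _
  have hinj : InjOn (Function.update id b a) (M ＼ {a}).E := by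
    have : (M ＼ {a}).E = insert b (M.E \ {a, b}) := by
      ext y
      by_cases hyb : y = b
      · subst hyb; simp [hbE, hab.symm]
      · simp [hyb]
    rw [this, injOn_insert (by simp), (hne (by simp)).injOn_iff, (hne (by simp)).image_eq,
      Function.update_self]
    simp [injOn_id]
  convert ha.map hinj
  refine ext_indep ?_ fun I hI ↦ ?_
  · ext y
    simp only [delete_ground, map_ground, mem_image, mem_sdiff, mem_singleton_iff]
    constructor
    · rintro ⟨hy, hyb⟩
      by_cases hya : y = a
      · exact ⟨b, ⟨hbE, hab.symm⟩, by simp [hya]⟩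
      · exact ⟨y, ⟨hy, hya⟩, Function.update_of_ne hyb _ _⟩
    · rintro ⟨z, ⟨hz, hza⟩, rfl⟩
      by_cases hzb : z = b
      · simp [hzb, haE, hab]
      · rw [Function.update_of_ne hzb]
        exact ⟨hz, hzb⟩
  have hbI : b ∉ I := fun h ↦ (hI h).2 rfl
  rw [deleteElem_indep_iff, map_indep_iff]
  simp only [hbI, not_false_eq_true, and_true, deleteElem_indep_iff]
  by_cases haI : a ∈ I
  · obtain ⟨J, rfl, haJ⟩ : ∃ J, I = insert a J ∧ a ∉ J := ⟨I \ {a}, by simp [haI], by simp⟩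
    have hbJ : b ∉ J := fun h ↦ hbI (mem_insert_of_mem _ h)
    rw [h.insert_indep_iff_of_pair hab haJ hbJ]
    constructor
    · intro hi
      exact ⟨insert b J, ⟨hi, by simp [hab, haJ]⟩, (image_update_id_insert hbJ).symm⟩
    · rintro ⟨L, ⟨hL, haL⟩, hLJ⟩
      by_cases hbL : b ∈ L
      · obtain ⟨L, rfl, hbL'⟩ : ∃ J, L = insert b J ∧ b ∉ J := ⟨L \ {b}, by simp [hbL], by simp⟩
        rw [image_update_id_insert hbL'] at hLJ
        have haL' : a ∉ L := fun h ↦ haL (mem_insert_of_mem _ h)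
        have : J = L := by
          rw [← insert_sdiff_self_of_notMem haJ, hLJ, insert_sdiff_self_of_notMem haL']
        rwa [this]
      · rw [image_update_id_of_notMem hbL] at hLJ
        exact (haL (hLJ ▸ mem_insert _ _)).elim
  · constructor
    · exact fun hi ↦ ⟨I, ⟨hi, haI⟩, (image_update_id_of_notMem hbI).symm⟩
    · rintro ⟨L, ⟨hL, haL⟩, rfl⟩
      have hbL : b ∉ L := fun hb ↦ haI ⟨b, hb, Function.update_self ..⟩
      rwa [image_update_id_of_notMem hbL]

/-- Deleting one element of a parallel pair leaves a series-parallel matroid. -/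
def DeletionClosed (M : Matroid α) : Prop :=
  ∀ e f, e ≠ f → M.IsCircuit {e, f} → (M ＼ {e}).IsSeriesParallel

/-- The pair deleted from need not be the pair `{a, b}` created last. If `e ≠ a`, deletions of `a`
and `e` commute: delete `e` in the smaller matroid, then put `a` back parallel to an element other
than `e`. When `e = b` and `f = a`, exchanging the two copies suffices. -/
lemma IsParallelExtension.deletionClosed (h : IsParallelExtension M N)
    (hN : N.IsSeriesParallel) (hd : N.DeletionClosed) : M.DeletionClosed := by
  obtain ⟨a, b, hab, hC, rfl⟩ := isParallelExtension_iff.1 h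
  intro e f hef hc
  by_cases hea : e = a
  · exact hea ▸ hN
  have extend : ∀ g, a ≠ g → g ≠ e → M.IsCircuit {a, g} → (M ＼ {a} ＼ {e}).IsSeriesParallel →
      (M ＼ {e}).IsSeriesParallel := by
    intro g hag hge hg hsp
    refine .parallel hsp (isParallelExtension_iff.2 ⟨a, g, hag, ?_, delete_comm _ _ _⟩)
    rw [delete_isCircuit_iff]
    refine ⟨hg, ?_⟩
    rw [disjoint_singleton_right]
    simp [hea, hge.symm]
  have hdel : ∀ g, e ≠ g → g ≠ a → M.IsCircuit {e, g} → (M ＼ {a} ＼ {e}).IsSeriesParallel := by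
    intro g heg hga hg
    refine hd e g heg ?_
    rw [delete_isCircuit_iff]
    refine ⟨hg, ?_⟩
    rw [disjoint_singleton_right]
    simp [Ne.symm hea, hga.symm]
  by_cases hfa : f = a
  · subst hfa
    by_cases heb : e = b
    · subst heb
      exact hC.isSeriesParallel_delete_swap hab hN
    · exact extend b hab (Ne.symm heb) hC
        (hdel b heb hab.symm (hc.pair_trans hC hef hab heb))
  · refine (by_cases (p := b = e) (fun hbe ↦ ?_) fun hbe ↦ ?_)
    · subst hbe
      exact extend f (Ne.symm hfa) hef.symm (hC.pair_trans hc hab hef (Ne.symm hfa))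
        (hdel f hef hfa hc)
    · exact extend b hab hbe hC (hdel f hef hfa hc)

/-- In terms of `M`, this contracts an element of a two-element cocircuit `{e, f}`. If `{a, b}`
meets it, the two pairs coincide and connectedness leaves nothing else, so the contraction is a
single loop. Otherwise `a` and `b` stay parallel after contracting `e`, and `M ／ {e}` is a parallel
extension of `M ＼ {a} ／ {e}`. -/
lemma IsParallelExtension.deletionClosed_dual [Finite α] (h : IsParallelExtension M N)
    (hN : N.IsSeriesParallel) (hd : N✶.DeletionClosed) : M✶.DeletionClosed := by
  have hMc := h.isConn hN.isConn
  obtain ⟨a, b, hab, hC, rfl⟩ := isParallelExtension_iff.1 h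
  intro e f hef (hc : M.IsCocircuit {e, f})
  rw [← isSeriesParallel_dual_iff, dual_delete, dual_dual]
  have heE : e ∈ M.E := hc.subset_ground (by simp)
  have hfE : f ∈ M.E := hc.subset_ground (by simp)
  -- A circuit and a cocircuit never meet in exactly one element.
  have hnt : ∀ {D z}, M.IsCircuit D → z ∈ D → z ∈ ({e, f} : Set α) → e ∈ D ∧ f ∈ D := by
    intro D z hD hzD hz
    obtain ⟨y, ⟨hyD, hy⟩, hyz⟩ :=
      (hD.isCocircuit_inter_nontrivial hc ⟨z, hzD, hz⟩).exists_ne z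
    rcases hz with rfl | rfl <;> rcases hy with rfl | rfl <;> simp_all
  by_cases hea : a ∈ ({e, f} : Set α) ∨ b ∈ ({e, f} : Set α)
  · have hef' : M.IsCircuit {e, f} := by
      obtain ⟨h1, h2⟩ : e ∈ ({a, b} : Set α) ∧ f ∈ ({a, b} : Set α) := by
        rcases hea with h | h
        · exact hnt hC (by simp) h
        · exact hnt hC (by simp) h
      convert hC using 1
      rcases h1 with rfl | rfl <;> rcases h2 with rfl | rfl <;> simp_all [pair_comm]
    have hE : M.E = {e, f} := by
      refine Subset.antisymm (fun g hg ↦ ?_) hc.subset_ground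
      rw [← hMc e heE] at hg
      rcases hg with rfl | ⟨D, hD, heD, hgD⟩
      · simp
      · obtain ⟨-, hfD⟩ := hnt hD heD (by simp)
        rwa [hef'.eq_of_subset_isCircuit hD (pair_subset heD hfD)]
    have : M ／ {e} = loopyOn {f} := by
      have hE' : M.E \ {e} = {f} := by
        rw [hE]; ext y
        simp only [mem_sdiff, mem_insert_iff, mem_singleton_iff]
        constructor
        · rintro ⟨rfl | rfl, h⟩ <;> simp_all
        · rintro rfl; exact ⟨Or.inr rfl, hef.symm⟩
      rw [eq_loopyOn_iff_loops]
      refine ⟨?_, hE'⟩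
      refine Subset.antisymm ((loops_subset_ground _).trans hE'.subset) ?_
      rw [singleton_subset_iff]
      change (M ／ {e}).IsLoop f
      rw [contract_isLoop_iff_mem_closure, hef'.closure_pair_eq hef]
      exact ⟨M.mem_closure_of_mem' rfl, by simp [hef.symm]⟩
    rw [this]
    exact .loop f
  simp only [not_or, mem_insert_iff, mem_singleton_iff] at hea
  obtain ⟨⟨hae, haf⟩, hbe, hbf⟩ := hea
  have hcl : ∀ {c}, M.IsNonloop c → c ≠ e → c ≠ f → ¬ (M ／ {e}).IsLoop c := by
    intro c hcn hce hcf hl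
    rw [contract_isLoop_iff_mem_closure] at hl
    have h2 : M.closure {c} = M.closure {e} := hcn.closure_eq_of_mem_closure hl.1
    rw [hcn.closure_eq_closure_iff_isCircuit_of_ne hce] at h2
    rcases (hnt h2 (z := e) (by simp) (by simp)).2 with h | h
    exacts [hcf h.symm, hef h.symm]
  have habM : (M ／ {e}).IsCircuit {a, b} := by
    refine Dep.isCircuit_pair (hC.contract_dep ?_) (hcl (hC.isNonloop_left hab) hae haf)
      (hcl (hC.isNonloop_right hab) hbe hbf)
    rw [disjoint_singleton_left]
    simp [Ne.symm hae, Ne.symm hbe]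
  refine .parallel (M := M ＼ {a} ／ {e}) ?_ (isParallelExtension_iff.2 ⟨a, b, hab, habM, ?_⟩)
  · rw [← isSeriesParallel_dual_iff, dual_contract]
    refine hd e f hef ?_
    -- Connectedness of `M ＼ {a}` rules out coloops, so `{e, f}` does not shrink as a cocircuit when
    -- `a` is deleted.
    have hco : ∀ {c d}, c ∈ M.E → d ∈ M.E → c ≠ d → c ≠ a → d ≠ a →
        ¬ (M ＼ {a})✶.IsLoop c := by
      intro c d hcE hdE hcd hca hda hl
      have hd' : d ∈ (M ＼ {a}).component c := by
        rw [hN.isConn c ⟨hcE, hca⟩]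
        exact ⟨hdE, hda⟩
      rcases hd' with rfl | ⟨D, hD, hcD, -⟩
      · exact hcd rfl
      · exact hD.not_isColoop_of_mem hcD hl
    refine Dep.isCircuit_pair ?_ (hco heE hfE hef (Ne.symm hae) (Ne.symm haf))
      (hco hfE heE hef.symm (Ne.symm haf) (Ne.symm hae))
    rw [dual_delete]
    refine IsCircuit.contract_dep hc ?_
    rw [disjoint_singleton_left]
    simp [hae, haf]
  · exact contract_delete_comm M (by simp [Ne.symm hae])

/-- Both halves must be proved at once: a series extension of `M` is a parallel extension of `M✶`,
so that step swaps the two halves. -/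
lemma IsSeriesParallel.deletionClosed_and_dual [Finite α] (h : M.IsSeriesParallel) :
    M.DeletionClosed ∧ M✶.DeletionClosed := by
  induction h with
  | loop e =>
    constructor <;> intro x y hxy hc <;>
      exact (hxy (subsingleton_singleton (hc.subset_ground (by simp))
        (hc.subset_ground (by simp)))).elim
  | coloop e =>
    constructor <;> intro x y hxy hc <;>
      exact (hxy (subsingleton_singleton (hc.subset_ground (by simp))
        (hc.subset_ground (by simp)))).elim
  | parallel hM h ih => exact ⟨h.deletionClosed hM ih.1, h.deletionClosed_dual hM ih.2⟩
  | @series M M' hM h ih =>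
    have h' := dual_isParallelExtension_iff.2 h
    have h2 := h'.deletionClosed_dual hM.dual (by simpa using ih.1)
    exact ⟨by simpa using h2, h'.deletionClosed hM.dual ih.2⟩

lemma IsCircuit.isSeriesParallel_delete_iff [Finite α] (h : M.IsCircuit {x, u}) (hxu : x ≠ u) :
    (M ＼ {x}).IsSeriesParallel ↔ M.IsSeriesParallel :=
  ⟨fun hsp ↦ .parallel hsp (isParallelExtension_iff.2 ⟨x, u, hxu, h, rfl⟩),
    fun hsp ↦ hsp.deletionClosed_and_dual.1 x u hxu h⟩

/-- The only circuit through `u` destroyed by the deletion is `{x, u}` itself. -/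
lemma IsCircuit.component_delete_eq (h : M.IsCircuit {x, u}) (hxu : x ≠ u) :
    (M ＼ {x}).component u = M.component u \ {x} := by
  ext f
  constructor
  · rintro (rfl | ⟨C, hC, hu, hf⟩)
    · exact ⟨M.mem_component_self _, hxu.symm⟩
    · exact ⟨hC.of_delete.mem_component hu hf, (hC.subset_ground hf).2⟩
  · rintro ⟨rfl | ⟨C, hC, hu, hf⟩, hfx : f ≠ x⟩
    · exact mem_component_self _ _
    · by_cases hxC : x ∈ C
      · have := h.eq_of_subset_isCircuit hC (pair_subset hxC hu)
        rw [← this] at hf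
        rcases hf with rfl | rfl
        · exact (hfx rfl).elim
        · exact mem_component_self _ _
      · refine IsCircuit.mem_component (C := C) ?_ hu hf
        rw [delete_isCircuit_iff]
        exact ⟨hC, by simpa using hxC⟩

lemma IsCircuit.isQuasiSeriesParallel_delete_iff [Finite α] (h : M.IsCircuit {x, u})
    (hxu : x ≠ u) : (M ＼ {x}).IsQuasiSeriesParallel ↔ M.IsQuasiSeriesParallel := by
  have hs := h.subset_ground
  have huE : u ∈ M.E := hs (by simp)
  have hxK : x ∈ M.component u := h.mem_component (by simp) (by simp)
  have hK := component_subset_ground huE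
  rw [isQuasiSeriesParallel_iff_of_mem_ground huE,
    isQuasiSeriesParallel_iff_of_mem_ground (M := M ＼ {x}) (e := u) ⟨huE, hxu.symm⟩,
    h.component_delete_eq hxu]
  refine and_congr ?_ ?_
  · have : (M ＼ {x}) ↾ (M.component u \ {x}) = (M ↾ M.component u) ＼ {x} := by
      rw [delete_eq_restrict, delete_eq_restrict, restrict_ground_eq,
        restrict_restrict_eq _ (sdiff_subset_sdiff_left hK), restrict_restrict_eq _ sdiff_subset]
    rw [this]
    refine IsCircuit.isSeriesParallel_delete_iff (u := u) ?_ hxu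
    rw [restrict_isCircuit_iff hK]
    exact ⟨h, pair_subset hxK (M.mem_component_self u)⟩
  · have : (M ＼ {x}).E \ (M.component u \ {x}) = M.E \ M.component u := by
      ext y
      simp only [delete_ground, mem_sdiff, mem_singleton_iff]
      constructor
      · rintro ⟨⟨h1, h2⟩, h3⟩
        exact ⟨h1, fun h ↦ h3 ⟨h, h2⟩⟩
      · rintro ⟨h1, h2⟩
        exact ⟨⟨h1, by rintro rfl; exact h2 hxK⟩, fun h ↦ h2 h.1⟩
    rw [this, delete_eq_restrict, restrict_restrict_eq]
    rintro y ⟨h1, h2⟩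
    exact ⟨h1, by rintro rfl; exact h2 hxK⟩

/-- A loop is a component by itself, and a single loop is series-parallel. -/
lemma IsLoop.isQuasiSeriesParallel_delete_iff [Finite α] (h : M.IsLoop x) :
    (M ＼ {x}).IsQuasiSeriesParallel ↔ M.IsQuasiSeriesParallel := by
  have hK : M.component x = {x} := by
    ext y
    constructor
    · rintro (rfl | ⟨C, hC, hx, hy⟩)
      · rfl
      · exact h.eq_of_isCircuit_mem hC hx ▸ hy
    · rintro rfl
      exact M.mem_component_self _
  rw [isQuasiSeriesParallel_iff_of_mem_ground h.mem_ground, hK,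
    restrict_subset_loops_eq (singleton_subset_iff.2 h), delete_eq_restrict,
    and_iff_right (.loop x)]

lemma IsLoop.eRank_delete_eq (h : M.IsLoop x) : (M ＼ {x}).eRank = M.eRank := by
  rw [delete_eq_restrict, eRank_restrict, eRk_eq_eRk_sdiff_eRk_le_zero M.E h.eRk_eq.le, eRk_ground]

lemma IsLoop.restrict_insert_delete (h : M.IsLoop x) : (M ＼ {x}) ↾ M.E = M := by
  refine ext_indep rfl fun I hI ↦ ?_
  rw [restrict_indep_iff, deleteElem_indep_iff]
  exact ⟨fun h ↦ h.1.1, fun hI' ↦ ⟨⟨hI', h.notMem_of_indep hI'⟩, hI⟩⟩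

lemma restrict_insert_isLoop (hx : x ∉ N.E) : (N ↾ insert x N.E).IsLoop x := by
  rw [restrict_isLoop_iff]
  exact ⟨mem_insert _ _, Or.inr hx⟩

lemma restrict_insert_delete (hx : x ∉ N.E) : (N ↾ insert x N.E) ＼ {x} = N := by
  rw [delete_eq_restrict, restrict_ground_eq, insert_sdiff_self_of_notMem hx,
    restrict_restrict_eq _ (subset_insert _ _), restrict_ground_eq_self]

end Parallel

end Matroid

namespace Matroid

open Set

/-! ### Counting labelings up to equivalence -/

section Labeling

variable {α : Type*} {M N : Matroid α} {G : Type*} [Group G]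

/-- The number of equivalence classes of `G`-labelings. -/
noncomputable def labelCount (G : Type*) [Group G] (M : Matroid α) : ℕ :=
  Nat.card (Quotient (labelingSetoid G M))

/-- The components of the sum are those of the two summands, so equivalence can be tested on each
summand separately. -/
lemma labelCount_disjointSum (h : Disjoint M.E N.E) :
    labelCount G (M.disjointSum N h) = labelCount G M * labelCount G N := by
  classical
  have hE : (M.disjointSum N h).E = M.E ∪ N.E := disjointSum_ground_eq
  have hM : ∀ {x}, x ∈ M.E → x ∈ (M.disjointSum N h).E := fun hx ↦ hE ▸ Or.inl hx
  have hN : ∀ {x}, x ∈ N.E → x ∈ (M.disjointSum N h).E := fun hx ↦ hE ▸ Or.inr hx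
  let rM : ((M.disjointSum N h).E → G) → (M.E → G) := fun a e ↦ a ⟨e, hM e.2⟩
  let rN : ((M.disjointSum N h).E → G) → (N.E → G) := fun a e ↦ a ⟨e, hN e.2⟩
  have key : ∀ a b, (labelingSetoid G (M.disjointSum N h)).r a b ↔
      (labelingSetoid G M).r (rM a) (rM b) ∧ (labelingSetoid G N).r (rN a) (rN b) := by
    intro a b
    constructor
    · intro hab
      constructor
      · intro K hK
        obtain ⟨g, hg⟩ := hab K ((disjointSum_isComponent_iff h).2 (Or.inl hK))
        exact ⟨g, fun e he ↦ hg ⟨e, hM e.2⟩ he⟩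
      · intro K hK
        obtain ⟨g, hg⟩ := hab K ((disjointSum_isComponent_iff h).2 (Or.inr hK))
        exact ⟨g, fun e he ↦ hg ⟨e, hN e.2⟩ he⟩
    · rintro ⟨h1, h2⟩ K hK
      rcases (disjointSum_isComponent_iff h).1 hK with hK | hK
      · obtain ⟨g, hg⟩ := h1 K hK
        exact ⟨g, fun e he ↦ hg ⟨e, hK.subset_ground he⟩ he⟩
      · obtain ⟨g, hg⟩ := h2 K hK
        exact ⟨g, fun e he ↦ hg ⟨e, hK.subset_ground he⟩ he⟩
  rw [labelCount, labelCount, labelCount, ← Nat.card_prod]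
  refine Nat.card_congr (Equiv.ofBijective
    (fun x ↦ (Quotient.map rM (fun a b hab ↦ ((key a b).1 hab).1) x,
      Quotient.map rN (fun a b hab ↦ ((key a b).1 hab).2) x)) ⟨?_, ?_⟩)
  · intro x y hxy
    induction x using Quotient.inductionOn with | _ a
    induction y using Quotient.inductionOn with | _ b
    simp only [Quotient.map_mk, Prod.mk.injEq] at hxy
    exact Quotient.sound ((key a b).2 ⟨Quotient.exact hxy.1, Quotient.exact hxy.2⟩)
  · rintro ⟨x, y⟩
    induction x using Quotient.inductionOn with | _ a
    induction y using Quotient.inductionOn with | _ b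
    let c : (M.disjointSum N h).E → G := fun e ↦
      if he : (e : α) ∈ M.E then a ⟨e, he⟩
      else if he' : (e : α) ∈ N.E then b ⟨e, he'⟩ else 1
    refine ⟨Quotient.mk _ c, ?_⟩
    simp only [Quotient.map_mk]
    have h1 : rM c = a := funext fun e ↦ by simp [rM, c]
    have h2 : rN c = b := funext fun e ↦ by
      simp [rN, c, h.notMem_of_mem_right e.2]
    rw [h1, h2]

/-- With one component the classes are the orbits of `G` acting freely by left multiplication. A
labeling is therefore determined by its class and its value at a base point `e₀`. -/
lemma IsConn.card_mul_labelCount [Finite α] [Finite G] (hM : M.IsConn) (hne : M.E.Nonempty) :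
    Nat.card G * labelCount G M = Nat.card G ^ M.E.ncard := by
  obtain ⟨e₀, he₀⟩ := hne
  have key : ∀ a b : M.E → G, (labelingSetoid G M).r a b ↔ ∃ g, ∀ e, a e = g * b e := by
    intro a b
    constructor
    · intro hab
      obtain ⟨g, hg⟩ := hab _ ⟨e₀, he₀, (hM e₀ he₀).symm⟩
      exact ⟨g, fun e ↦ hg e e.2⟩
    · rintro ⟨g, hg⟩ K -
      exact ⟨g, fun e _ ↦ hg e⟩
  have hc : Nat.card (M.E → G) = Nat.card G ^ M.E.ncard := by
    rw [Nat.card_fun, Nat.card_coe_set_eq]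
  rw [labelCount, ← hc, ← Nat.card_prod]
  refine (Nat.card_congr (Equiv.ofBijective
    (fun a : M.E → G ↦ (a ⟨e₀, he₀⟩, Quotient.mk (labelingSetoid G M) a)) ⟨?_, ?_⟩)).symm
  · intro a b hab
    simp only [Prod.mk.injEq] at hab
    obtain ⟨g, hg⟩ := (key a b).1 (Quotient.exact hab.2)
    have hg1 : g = 1 := by
      have := hg ⟨e₀, he₀⟩
      rw [hab.1] at this
      exact right_eq_mul.1 this
    funext e
    rw [hg e, hg1, one_mul]
  · rintro ⟨g, x⟩
    induction x using Quotient.inductionOn with | _ a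
    refine ⟨fun e ↦ (g * (a ⟨e₀, he₀⟩)⁻¹) * a e, ?_⟩
    simp only [inv_mul_cancel_right, Prod.mk.injEq, true_and]
    exact Quotient.sound ((key _ _).2 ⟨_, fun e ↦ rfl⟩)

end Labeling

instance finite_matroid {α : Type*} [Finite α] : Finite (Matroid α) := by
  refine Finite.of_injective (fun M : Matroid α ↦ (M.E, {I | M.Indep I})) fun M N h ↦ ?_
  simp only [Prod.mk.injEq] at h
  exact ext_indep h.1 fun I _ ↦ Set.ext_iff.1 h.2 I

/-! ### The exponential formula for matroids -/

section Sum

variable {α : Type*} [Finite α] {R : Type*} [CommRing R]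

/-- The finset of all matroids with ground set `E`. -/
noncomputable def matroidsOn (E : Finset α) : Finset (Matroid α) :=
  (toFinite {M : Matroid α | M.E = E}).toFinset

@[simp] lemma mem_matroidsOn {E : Finset α} {M : Matroid α} : M ∈ matroidsOn E ↔ M.E = E := by
  simp [matroidsOn]

open Classical in
/-- Splitting off the component of `e`. -/
lemma sum_matroidsOn_insert (w : Matroid α → R)
    (hw : ∀ M N (h : Disjoint M.E N.E), w (M.disjointSum N h) = w M * w N)
    {e : α} {E : Finset α} (he : e ∉ E) :
    ∑ M ∈ matroidsOn (insert e E), w M =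
      ∑ T ∈ E.powerset, (∑ M ∈ (matroidsOn (insert e T)).filter IsConn, w M) *
        ∑ N ∈ matroidsOn (E \ T), w N := by
  simp only [Finset.sum_mul_sum, ← Finset.sum_product']
  rw [Finset.sum_sigma']
  have hT : ∀ {M : Matroid α}, M.E = ↑(insert e E) →
      (↑(insert e ((toFinite (M.component e)).toFinset.erase e)) : Set α) = M.component e := by
    intro M hM
    rw [Finset.insert_erase (by simpa using M.mem_component_self e), Finite.coe_toFinset]
  have hE : ∀ {M : Matroid α}, M.E = ↑(insert e E) →
      (↑(E \ ((toFinite (M.component e)).toFinset.erase e)) : Set α) =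
        M.E \ M.component e := by
    intro M hM
    ext x
    have := M.mem_component_self e
    by_cases hx : x = e
    · subst hx; simp [he, this]
    · simp [hM, hx]
  -- `T` is the component of `e` without `e`. The `else` branch of `j` is a dummy: on the index set
  -- the ground sets `insert e T` and `E \ T` are disjoint.
  refine Finset.sum_bij'
    (i := fun M _ ↦ ⟨(toFinite (M.component e)).toFinset.erase e,
      (M ↾ M.component e, M ↾ (M.E \ M.component e))⟩)
    (j := fun p _ ↦ if h : Disjoint p.2.1.E p.2.2.E then p.2.1.disjointSum p.2.2 h else p.2.1)
    ?_ ?_ ?_ ?_ ?_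
  · intro M hM
    rw [mem_matroidsOn] at hM
    have heM : e ∈ M.E := by simp [hM]
    simp only [Finset.mem_sigma, Finset.mem_powerset, Finset.mem_product, Finset.mem_filter,
      mem_matroidsOn, restrict_ground_eq, hT hM, hE hM, isConn_restrict_component heM, and_self,
      and_true]
    intro x hx
    simp only [Finset.mem_erase, Finite.mem_toFinset] at hx
    have := component_subset_ground heM hx.2
    rw [hM] at this
    simpa [hx.1] using this
  · rintro ⟨T, M, N⟩ hp
    simp only [Finset.mem_sigma, Finset.mem_powerset, Finset.mem_product, Finset.mem_filter,
      mem_matroidsOn] at hp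
    obtain ⟨hTE, ⟨hM, -⟩, hN⟩ := hp
    have hd : Disjoint M.E N.E := by
      rw [hM, hN, Finset.disjoint_coe, Finset.disjoint_insert_left]
      exact ⟨by simp [he], Finset.disjoint_sdiff⟩
    rw [mem_matroidsOn, dif_pos hd, disjointSum_ground_eq, hM, hN]
    rw [← Finset.coe_union, Finset.insert_union, Finset.union_sdiff_of_subset hTE]
  · intro M hM
    rw [mem_matroidsOn] at hM
    have heM : e ∈ M.E := by simp [hM]
    have hd : Disjoint (M ↾ M.component e).E (M ↾ (M.E \ M.component e)).E :=
      disjoint_sdiff_right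
    simp only [hd, dite_true]
    exact disjointSum_component_compl heM hd
  · rintro ⟨T, M, N⟩ hp
    simp only [Finset.mem_sigma, Finset.mem_powerset, Finset.mem_product, Finset.mem_filter,
      mem_matroidsOn] at hp
    obtain ⟨hTE, ⟨hM, hMc⟩, hN⟩ := hp
    have hd : Disjoint M.E N.E := by
      rw [hM, hN, Finset.disjoint_coe, Finset.disjoint_insert_left]
      exact ⟨by simp [he], Finset.disjoint_sdiff⟩
    simp only [hd, dite_true]
    have heM : e ∈ M.E := by simp [hM]
    have hcomp : (M.disjointSum N hd).component e = M.E := by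
      rw [disjointSum_component_left hd heM, hMc e heM]
    have hg : (M.disjointSum N hd).E \ M.E = N.E := by
      rw [disjointSum_ground_eq, union_sdiff_left, hd.symm.sdiff_eq_left]
    have h1 : (M.disjointSum N hd) ↾ M.E = M := by
      rw [disjointSum_restrict_left hd Subset.rfl, restrict_ground_eq_self]
    have h2 : (M.disjointSum N hd) ↾ N.E = N := by
      rw [disjointSum_restrict_right hd Subset.rfl, restrict_ground_eq_self]
    have h3 : (toFinite ((M.disjointSum N hd).component e)).toFinset.erase e = T := by
      ext x
      simp only [Finset.mem_erase, Finite.mem_toFinset, hcomp, hM]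
      by_cases hx : x = e
      · subst hx
        simp only [ne_eq, not_true_eq_false, false_and, false_iff]
        exact fun h ↦ he (hTE h)
      · simp [hx]
    rw [h3, hcomp, hg, h1, h2]
  · intro M hM
    rw [mem_matroidsOn] at hM
    have heM : e ∈ M.E := by simp [hM]
    have hd : Disjoint (M ↾ M.component e).E (M ↾ (M.E \ M.component e)).E :=
      disjoint_sdiff_right
    rw [← hw _ _ hd, disjointSum_component_compl heM hd]

open Classical in
/-- The exponential formula, in the form of a differential equation. -/
lemma sum_matroidsOn_eq_factorial_mul_coeff (w : Matroid α → R)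
    (hw : ∀ M N (h : Disjoint M.E N.E), w (M.disjointSum N h) = w M * w N)
    (hw₀ : w (emptyOn α) = 1) (C F : R⟦X⟧)
    (hC : ∀ B : Finset α, B.Nonempty →
      ∑ M ∈ (matroidsOn B).filter IsConn, w M = (B.card ! : R) * PowerSeries.coeff B.card C)
    (hF₀ : PowerSeries.constantCoeff F = 1)
    (hF : PowerSeries.derivative R F = PowerSeries.derivative R C * F) (E : Finset α) :
    ∑ M ∈ matroidsOn E, w M = (E.card ! : R) * PowerSeries.coeff E.card F := by
  induction hn : E.card using Nat.strong_induction_on generalizing E with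
  | _ n ih =>
  rcases E.eq_empty_or_nonempty with rfl | ⟨e, he⟩
  · have : matroidsOn (∅ : Finset α) = {emptyOn α} := by
      ext M
      simp [← ground_eq_empty_iff]
    rw [Finset.card_empty] at hn
    subst hn
    simp [this, hw₀, hF₀]
  obtain ⟨E, rfl, heE⟩ : ∃ E', E = insert e E' ∧ e ∉ E' :=
    ⟨E.erase e, by simp [Finset.insert_erase he], by simp⟩
  rw [Finset.card_insert_of_notMem heE] at hn
  subst hn
  rw [sum_matroidsOn_insert w hw heE]
  have h1 : ∀ T ∈ E.powerset, (∑ M ∈ (matroidsOn (insert e T)).filter IsConn, w M) *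
        ∑ N ∈ matroidsOn (E \ T), w N =
      (((T.card + 1) ! : R) * PowerSeries.coeff (T.card + 1) C) *
        (((E.card - T.card) ! : R) * PowerSeries.coeff (E.card - T.card) F) := by
    intro T hT
    rw [Finset.mem_powerset] at hT
    have heT : e ∉ T := fun h ↦ heE (hT h)
    rw [hC _ (Finset.insert_nonempty _ _), Finset.card_insert_of_notMem heT,
      ih _ ?_ (E \ T) rfl, Finset.card_sdiff_of_subset hT]
    exact Nat.lt_succ_of_le (Finset.card_le_card Finset.sdiff_subset)
  rw [Finset.sum_congr rfl h1, Finset.sum_powerset_apply_card (fun k ↦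
      (((k + 1) ! : R) * PowerSeries.coeff (k + 1) C) *
        (((E.card - k) ! : R) * PowerSeries.coeff (E.card - k) F))]
  -- The recursion over the size `k` of `T` is this coefficient of F' = C'F; the shift to `k + 1`
  -- counts `e` itself and is absorbed by the derivative.
  have h2 := congrArg (PowerSeries.coeff E.card) hF
  rw [PowerSeries.coeff_derivative, PowerSeries.coeff_mul,
    Finset.Nat.sum_antidiagonal_eq_sum_range_succ_mk] at h2
  rw [Nat.factorial_succ]
  push_cast
  calc _ = (E.card ! : R) * (∑ k ∈ Finset.range E.card.succ,
        PowerSeries.coeff k (PowerSeries.derivative R C) *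
          PowerSeries.coeff (E.card - k) F) := ?_
    _ = _ := by rw [← h2]; ring
  rw [Finset.mul_sum]
  refine Finset.sum_congr rfl fun k hk ↦ ?_
  have hk' : k ≤ E.card := Nat.lt_succ_iff.1 (Finset.mem_range.1 hk)
  rw [PowerSeries.coeff_derivative, ← Nat.choose_mul_factorial_mul_factorial hk',
    Nat.factorial_succ]
  push_cast
  rw [nsmul_eq_mul]
  ring

lemma sum_matroidsOn_map {β : Type*} [Fintype β] (w : Matroid α → R) (f : β ↪ α) :
    ∑ M ∈ matroidsOn (Finset.univ.map f), w M =
      ∑ M ∈ matroidsOn (Finset.univ : Finset β), w (M.map f f.injective.injOn) := by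
  refine Finset.sum_nbij' (fun M ↦ M.comap f) (fun M ↦ M.map f f.injective.injOn) ?_ ?_ ?_ ?_ ?_
  · intro M hM
    rw [mem_matroidsOn] at hM ⊢
    simp [hM]
  · intro M hM
    rw [mem_matroidsOn] at hM ⊢
    simp [hM]
  · intro M hM
    rw [mem_matroidsOn] at hM
    exact map_comap (by simp [hM]) f.injective.injOn
  · intro M _
    exact comap_map f.injective
  · intro M hM
    rw [mem_matroidsOn] at hM
    rw [map_comap (by simp [hM]) f.injective.injOn]

/-- Transports sums over an arbitrary ground set `B` to `Fin n`, where the generating functions are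
defined. -/
lemma sum_matroidsOn_eq_sum_fin (w : Matroid α → R) (B : Finset α) {n : ℕ} (hB : B.card = n)
    (w' : Matroid (Fin n) → R)
    (hw : ∀ (f : Fin n ↪ α) (M : Matroid (Fin n)), w (M.map f f.injective.injOn) = w' M) :
    ∑ M ∈ matroidsOn B, w M = ∑ M ∈ matroidsOn (Finset.univ : Finset (Fin n)), w' M := by
  let f : Fin n ↪ α := (B.equivFinOfCardEq hB).symm.toEmbedding.trans (Function.Embedding.subtype _)
  have hf : Finset.univ.map f = B := by
    rw [← Finset.map_map, Finset.map_univ_equiv, Finset.univ_eq_attach, Finset.attach_map_val]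
  rw [← Finset.sum_congr rfl fun M _ ↦ hw f M, ← sum_matroidsOn_map, hf]

end Sum

end Matroid

namespace PowerSeries

/-! ### Uniqueness for first-order linear differential equations -/

section ODE

variable {A : Type*} [CommRing A] [IsDomain A] [CharZero A]

/-- Coefficient `n` of the equation expresses `n + 1` times the next coefficient through earlier
ones, and `n + 1` can be cancelled. -/
lemma eq_of_derivative_eq_mul {u v g : A⟦X⟧} (hu : derivative A u = g * u)
    (hv : derivative A v = g * v) (h : constantCoeff u = constantCoeff v) : u = v := by
  ext n
  induction n using Nat.strong_induction_on with
  | _ n ih =>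
  cases n with
  | zero => simpa using h
  | succ n =>
    have h1 := congrArg (coeff n) hu
    have h2 := congrArg (coeff n) hv
    rw [coeff_derivative, coeff_mul] at h1 h2
    have h3 : (n + 1 : A) ≠ 0 := Nat.cast_add_one_ne_zero n
    refine mul_right_cancel₀ h3 ?_
    rw [h1, h2]
    refine Finset.sum_congr rfl fun p hp ↦ ?_
    rw [ih p.2 (by have := Finset.HasAntidiagonal.mem_antidiagonal.1 hp; omega)]

lemma eq_of_mul_derivative_eq_mul {u v f g : A⟦X⟧} (hf : constantCoeff f = 1)
    (hu : f * derivative A u = g * u) (hv : f * derivative A v = g * v)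
    (h : constantCoeff u = constantCoeff v) : u = v := by
  have hf' : invOfUnit f 1 * f = 1 := invOfUnit_mul f 1 (by simpa using hf)
  refine eq_of_derivative_eq_mul (g := invOfUnit f 1 * g) ?_ ?_ h
  · rw [mul_assoc, ← hu, ← mul_assoc, hf', one_mul]
  · rw [mul_assoc, ← hv, ← mul_assoc, hf', one_mul]

end ODE

/-! ### Substitution into exp and log -/

section Subst

variable {A : Type*} [CommRing A]

lemma constantCoeff_subst_of_constantCoeff_eq_zero (f : A⟦X⟧) {g : A⟦X⟧}
    (hg : constantCoeff g = 0) : constantCoeff (f.subst g) = constantCoeff f := by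
  have hs : HasSubst g := HasSubst.of_constantCoeff_zero' hg
  have h := constantCoeff_subst_eq_zero (a := g) hg (f - C (constantCoeff f)) (by simp)
  rw [subst_sub hs, subst_C] at h
  rw [map_sub, sub_eq_zero] at h
  exact h.trans (by simp)

lemma one_subst {g : A⟦X⟧} (hg : HasSubst g) : (1 : A⟦X⟧).subst g = 1 := by
  rw [← coe_substAlgHom hg, map_one]

variable [Algebra ℚ A]

lemma constantCoeff_exp_subst {g : A⟦X⟧} (hg : constantCoeff g = 0) :
    constantCoeff ((exp A).subst g) = 1 := by
  rw [constantCoeff_subst_of_constantCoeff_eq_zero _ hg, constantCoeff_exp]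

lemma derivative_exp_subst {g : A⟦X⟧} (hg : constantCoeff g = 0) :
    derivative A ((exp A).subst g) = derivative A g * (exp A).subst g := by
  rw [derivative_subst (HasSubst.of_constantCoeff_zero' hg), derivative_exp, mul_comm]

lemma one_add_X_mul_derivative_log : (1 + X) * derivative A (log A) = 1 := by
  rw [deriv_log]
  ext n
  cases n with
  | zero => simp [coeff_zero_eq_constantCoeff_apply]
  | succ n =>
    rw [add_mul, one_mul, map_add, coeff_succ_X_mul, coeff_mk, coeff_mk, ← map_add, pow_succ]
    simp [coeff_one]

/-- Both sides solve f · u' = f' · u with constant coefficient 1. -/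
lemma exp_subst_logOf [IsDomain A] [CharZero A] {f : A⟦X⟧} (hf : constantCoeff f = 1) :
    (exp A).subst (logOf f) = f := by
  have h0 : constantCoeff (logOf f) = 0 := constantCoeff_logOf hf
  have hs : HasSubst (f - 1) := HasSubst.of_constantCoeff_zero' (by simp [hf])
  refine eq_of_mul_derivative_eq_mul (f := f) (g := derivative A f) hf ?_ (mul_comm _ _) ?_
  · rw [derivative_exp_subst h0, logOf_eq, derivative_subst hs]
    have h1 := congrArg (subst (f - 1)) (one_add_X_mul_derivative_log (A := A))
    rw [subst_mul hs, subst_add hs, subst_X hs, one_subst hs, add_sub_cancel] at h1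
    rw [map_sub, derivative_one, sub_zero]
    calc _ = (f * (derivative A (log A)).subst (f - 1)) * derivative A f *
          (exp A).subst ((log A).subst (f - 1)) := by ring
      _ = _ := by rw [h1, one_mul]
  · rw [constantCoeff_exp_subst h0, hf]

/-- The series `exp(x)^(m+1) * S^(m)(exp(x)-1)`. -/
noncomputable def expIterSeries (S : A⟦X⟧) (m : ℕ) : A⟦X⟧ :=
  exp A ^ (m + 1) * ((derivative A)^[m] S).subst (exp A - 1)

/-- Differentiating the power of `exp` gives the factor `m + 1`; the chain rule supplies one more
derivative of `S` and one more factor `exp`. This is the analytic counterpart of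
`partialSimpleSum_insert`. -/
lemma derivative_expIterSeries (S : A⟦X⟧) (m : ℕ) :
    derivative A (expIterSeries S m) =
      (m + 1 : A⟦X⟧) * expIterSeries S m + expIterSeries S (m + 1) := by
  rw [expIterSeries, expIterSeries, Derivation.leibniz, derivative_subst HasSubst.exp_sub_one,
    derivative_pow, derivative_exp, map_sub, derivative_one, derivative_exp,
    Function.iterate_succ_apply', smul_eq_mul, smul_eq_mul]
  push_cast
  ring

lemma constantCoeff_expIterSeries (S : A⟦X⟧) (m : ℕ) :
    constantCoeff (expIterSeries S m) = (m ! : A) * coeff m S := by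
  rw [expIterSeries, map_mul, constantCoeff_subst_of_constantCoeff_eq_zero _
    (by rw [map_sub, constantCoeff_exp, map_one, sub_self]), map_pow, constantCoeff_exp, one_pow,
    one_mul, constantCoeff_iterate_derivative]

end Subst

/-! ### Rational powers as solutions of a differential equation -/

section RatPow

lemma one_add_X_mul_derivative_binomialSeries (r : ℚ) :
    (1 + X) * derivative ℚ[X] (binomialSeries ℚ[X] r) =
      C (Polynomial.C r) * binomialSeries ℚ[X] r := by
  -- The ratio of consecutive binomial coefficients is exactly the coefficientwise form of the
  -- equation.
  have key : ∀ n : ℕ, (Polynomial.C (Ring.choose r (n + 1)) : ℚ[X]) * (n + 1) =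
      Polynomial.C (Ring.choose r n) * (Polynomial.C r - n) := by
    intro n
    have := Ring.choose_smul_choose r (Nat.le_succ n)
    rw [Nat.succ_eq_add_one, Nat.choose_succ_self_right, Nat.add_sub_cancel_left,
      Ring.choose_one_right, nsmul_eq_mul] at this
    have h := congrArg (Polynomial.C : ℚ →+* ℚ[X]) this
    rw [map_mul, map_mul, map_sub, map_natCast, map_natCast] at h
    rw [← h, mul_comm]
    push_cast
    rfl
  have hc : ∀ n, coeff n (binomialSeries ℚ[X] r) = Polynomial.C (Ring.choose r n) := fun n ↦ by
    rw [binomialSeries_coeff, Algebra.smul_def, mul_one]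
    rfl
  ext1 n
  rw [add_mul, one_mul, map_add, coeff_derivative, coeff_C_mul, hc, hc, key]
  cases n with
  | zero => simp
  | succ n =>
    rw [coeff_succ_X_mul, coeff_derivative, hc]
    push_cast
    ring

end RatPow

end PowerSeries

open PowerSeries in
lemma constantCoeff_ratPow {f : ℚ[X]⟦X⟧} (hf : constantCoeff f = 1) (r : ℚ) :
    constantCoeff (ratPow f r) = 1 := by
  rw [ratPow, constantCoeff_subst_of_constantCoeff_eq_zero _ (by simp [hf]),
    binomialSeries_constantCoeff]

open PowerSeries in
lemma mul_derivative_ratPow {f : ℚ[X]⟦X⟧} (hf : constantCoeff f = 1) (r : ℚ) :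
    f * derivative ℚ[X] (ratPow f r) = (C (Polynomial.C r) * derivative ℚ[X] f) * ratPow f r := by
  have hs : HasSubst (f - 1) := HasSubst.of_constantCoeff_zero' (by simp [hf])
  have h := congrArg (subst (f - 1)) (one_add_X_mul_derivative_binomialSeries r)
  rw [subst_mul hs, subst_add hs, subst_X hs, one_subst hs, add_sub_cancel, subst_mul hs,
    subst_C] at h
  rw [ratPow, derivative_subst hs, ← mul_assoc, h, map_sub, derivative_one, sub_zero]
  change C (Polynomial.C r) * _ * _ = _
  ring

namespace Matroid

open Set

/-! ### Generating functions as rank-weighted sums over matroids -/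

section Weight

variable {α : Type*}

/-- The monomial recording the rank, with coefficient `ℓ M`. -/
noncomputable def rankWeight (ℓ : Matroid α → ℕ) (M : Matroid α) : ℚ[X] :=
  (ℓ M : ℚ[X]) * Polynomial.X ^ M.eRank.toNat

lemma eRank_ne_top_of_finite [Finite α] (M : Matroid α) : M.eRank ≠ ⊤ := by
  have h : M.E.encard < ⊤ := encard_lt_top_iff.2 (toFinite _)
  exact (M.eRank_le_encard_ground.trans_lt h).ne

lemma rankWeight_disjointSum [Finite α] {ℓ : Matroid α → ℕ}
    (hℓ : ∀ M N (h : Disjoint M.E N.E), ℓ (M.disjointSum N h) = ℓ M * ℓ N)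
    (M N : Matroid α) (h : Disjoint M.E N.E) :
    rankWeight ℓ (M.disjointSum N h) = rankWeight ℓ M * rankWeight ℓ N := by
  rw [rankWeight, rankWeight, rankWeight, hℓ, eRank_disjointSum,
    ENat.toNat_add (eRank_ne_top_of_finite M) (eRank_ne_top_of_finite N), pow_add]
  push_cast
  ring

open Classical in
-- The rank is at most `n`, so the truncation `k ≤ n` in the series discards no matroid.
lemma factorial_mul_coeff_bivariateEGF (a : ℕ → ℕ → ℕ) (n : ℕ) (ℓ : Matroid (Fin n) → ℕ)
    (h : ∀ k : ℕ, a n k = ∑ M ∈ (matroidsOn Finset.univ).filter (fun M ↦ M.eRank = (k : ℕ∞)), ℓ M) :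
    (n ! : ℚ[X]) * PowerSeries.coeff n (bivariateEGF a) =
      ∑ M ∈ matroidsOn Finset.univ, rankWeight ℓ M := by
  rw [bivariateEGF, PowerSeries.coeff_mk, Finset.mul_sum]
  have hmaps : ∀ M ∈ matroidsOn (Finset.univ : Finset (Fin n)),
      M.eRank.toNat ∈ Finset.range (n + 1) := by
    intro M _
    rw [Finset.mem_range, Nat.lt_succ_iff]
    refine ENat.toNat_le_of_le_natCast (M.eRank_le_encard_ground.trans ?_)
    refine (encard_le_encard (subset_univ _)).trans ?_
    rw [encard_univ, ENat.card_eq_coe_natCard, Nat.card_fin]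
  rw [← Finset.sum_fiberwise_of_maps_to hmaps]
  refine Finset.sum_congr rfl fun k _ ↦ ?_
  have hn : (n ! : ℚ) ≠ 0 := by exact_mod_cast n.factorial_ne_zero
  have h1 : (n ! : ℚ[X]) * Polynomial.monomial k ((a n k : ℚ) / (n ! : ℚ)) =
      (a n k : ℚ[X]) * Polynomial.X ^ k := by
    rw [← Polynomial.C_eq_natCast, Polynomial.C_mul_monomial, mul_div_cancel₀ _ hn,
      ← Polynomial.C_mul_X_pow_eq_monomial, ← Polynomial.C_eq_natCast]
  rw [h1, h]
  push_cast
  rw [Finset.sum_mul]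
  have h2 : (matroidsOn Finset.univ).filter (fun M : Matroid (Fin n) ↦ M.eRank = (k : ℕ∞)) =
      (matroidsOn Finset.univ).filter (fun M ↦ M.eRank.toNat = k) := by
    refine Finset.filter_congr fun M _ ↦ ?_
    rw [← ENat.natCast_toNat (eRank_ne_top_of_finite M), ENat.toNat_natCast, Nat.cast_inj]
  rw [h2]
  refine Finset.sum_congr rfl fun M hM ↦ ?_
  rw [rankWeight, (Finset.mem_filter.1 hM).2]

open Classical in
lemma natCard_subtype_eq_sum {n k : ℕ} (P : Matroid (Fin n) → Prop) [DecidablePred P] :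
    Nat.card {M : Matroid (Fin n) // M.E = univ ∧ P M ∧ M.eRank = (k : ℕ∞)} =
      ∑ M ∈ (matroidsOn Finset.univ).filter (fun M ↦ M.eRank = (k : ℕ∞)), if P M then 1 else 0 := by
  rw [Nat.subtype_card (((matroidsOn Finset.univ).filter (fun M ↦ M.eRank = (k : ℕ∞))).filter P),
    Finset.card_filter]
  intro M
  simp only [Finset.mem_filter, mem_matroidsOn, Finset.coe_univ]
  tauto

open Classical in
lemma factorial_mul_coeff_genC (n : ℕ) :
    (n ! : ℚ[X]) * PowerSeries.coeff n genC = ∑ M ∈ matroidsOn (Finset.univ : Finset (Fin n)),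
      rankWeight (fun M ↦ if M.IsSeriesParallel then 1 else 0) M :=
  factorial_mul_coeff_bivariateEGF _ _ _ fun _ ↦ natCard_subtype_eq_sum _

open Classical in
lemma natCard_simpleQSP {n k : ℕ} : Nat.card (SimpleQSP n k) =
    ∑ M ∈ (matroidsOn Finset.univ).filter (fun M : Matroid (Fin n) ↦ M.eRank = (k : ℕ∞)),
      if M.IsQuasiSeriesParallel ∧ M.IsSimple then 1 else 0 := by
  refine (Nat.card_congr (Equiv.subtypeEquivRight fun M ↦ ?_)).trans
    (natCard_subtype_eq_sum fun M ↦ M.IsQuasiSeriesParallel ∧ M.IsSimple)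
  tauto

open Classical in
lemma factorial_mul_coeff_genS (n : ℕ) :
    (n ! : ℚ[X]) * PowerSeries.coeff n genS = ∑ M ∈ matroidsOn (Finset.univ : Finset (Fin n)),
      rankWeight (fun M ↦ if M.IsQuasiSeriesParallel ∧ M.IsSimple then 1 else 0) M :=
  factorial_mul_coeff_bivariateEGF _ _ _ fun _ ↦ natCard_simpleQSP

open Classical in
lemma natCard_labeledSimpleQSP (G : Type*) [Group G] [Finite G] {n k : ℕ} :
    Nat.card (LabeledSimpleQSP G n k) =
      ∑ M ∈ (matroidsOn Finset.univ).filter (fun M : Matroid (Fin n) ↦ M.eRank = (k : ℕ∞)),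
        if M.IsQuasiSeriesParallel ∧ M.IsSimple then labelCount G M else 0 := by
  have : Finite (SimpleQSP n k) := Subtype.finite
  have := Fintype.ofFinite (SimpleQSP n k)
  have : ∀ M : SimpleQSP n k, Finite (Quotient (labelingSetoid G M.1)) :=
    fun M ↦ Quotient.finite _
  rw [LabeledSimpleQSP, Nat.card_sigma, ← Finset.sum_filter]
  refine (Finset.sum_subtype (p := fun M : Matroid (Fin n) ↦
    M.E = Set.univ ∧ M.IsQuasiSeriesParallel ∧ M.IsSimple ∧ M.eRank = (k : ℕ∞)) _ (fun M ↦ ?_)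
    (fun M ↦ labelCount G M)).symm
  simp only [Finset.mem_filter, mem_matroidsOn, Finset.coe_univ]
  tauto

open Classical in
lemma factorial_mul_coeff_genSG (G : Type*) [Group G] [Finite G] (n : ℕ) :
    (n ! : ℚ[X]) * PowerSeries.coeff n (genSG G) =
      ∑ M ∈ matroidsOn (Finset.univ : Finset (Fin n)), rankWeight
        (fun M ↦ if M.IsQuasiSeriesParallel ∧ M.IsSimple then labelCount G M else 0) M :=
  factorial_mul_coeff_bivariateEGF _ _ _ fun _ ↦ natCard_labeledSimpleQSP G

open Classical in
/-- The generating function of the simple series-parallel matroids. -/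
noncomputable def genSimpleSP : ℚ[X]⟦X⟧ :=
  bivariateEGF fun n k ↦ ∑ M ∈ (matroidsOn (Finset.univ : Finset (Fin n))).filter
    (fun M ↦ M.eRank = (k : ℕ∞)), if M.IsSeriesParallel ∧ M.IsSimple then 1 else 0

open Classical in
lemma factorial_mul_coeff_genSimpleSP (n : ℕ) :
    (n ! : ℚ[X]) * PowerSeries.coeff n genSimpleSP =
      ∑ M ∈ matroidsOn (Finset.univ : Finset (Fin n)),
        rankWeight (fun M ↦ if M.IsSeriesParallel ∧ M.IsSimple then 1 else 0) M :=
  factorial_mul_coeff_bivariateEGF _ _ _ fun _ ↦ rfl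

lemma not_isSeriesParallel_of_isEmpty [IsEmpty α] (M : Matroid α) : ¬ M.IsSeriesParallel := by
  intro h
  obtain ⟨x, -⟩ := h.ground_nonempty
  exact IsEmpty.false x

lemma constantCoeff_genC : PowerSeries.constantCoeff genC = 0 := by
  have h := factorial_mul_coeff_genC 0
  simpa [rankWeight, not_isSeriesParallel_of_isEmpty] using h

lemma constantCoeff_genSimpleSP : PowerSeries.constantCoeff genSimpleSP = 0 := by
  have h := factorial_mul_coeff_genSimpleSP 0
  simpa [rankWeight, not_isSeriesParallel_of_isEmpty] using h

open Classical in
-- On a nonempty ground set, connected and quasi series-parallel together mean series-parallel, so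
-- `genC` is the series of connected objects.
lemma sum_isConn_eq_factorial_mul_coeff_genC [Finite α] {B : Finset α} (hB : B.Nonempty) :
    ∑ M ∈ (matroidsOn B).filter IsConn,
      rankWeight (fun M ↦ if M.IsQuasiSeriesParallel then 1 else 0) M =
      (B.card ! : ℚ[X]) * PowerSeries.coeff B.card genC := by
  rw [factorial_mul_coeff_genC, ← sum_matroidsOn_eq_sum_fin
    (rankWeight (fun M ↦ if M.IsSeriesParallel then 1 else 0)) B rfl, Finset.sum_filter]
  · refine Finset.sum_congr rfl fun M hM ↦ ?_
    rw [mem_matroidsOn] at hM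
    have hne : M.E.Nonempty := by rw [hM]; exact hB
    by_cases hc : M.IsConn
    · simp [rankWeight, hc, hc.isQuasiSeriesParallel_iff hne]
    · simp [rankWeight, hc, mt IsSeriesParallel.isConn hc]
  · intro f M
    simp only [rankWeight, map_isSeriesParallel_iff f.injective, eRank_map]

open Classical in
lemma sum_isConn_eq_factorial_mul_coeff_genSimpleSP [Finite α] {B : Finset α}
    (hB : B.Nonempty) : ∑ M ∈ (matroidsOn B).filter IsConn,
      rankWeight (fun M ↦ if M.IsQuasiSeriesParallel ∧ M.IsSimple then 1 else 0) M =
      (B.card ! : ℚ[X]) * PowerSeries.coeff B.card genSimpleSP := by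
  rw [factorial_mul_coeff_genSimpleSP, ← sum_matroidsOn_eq_sum_fin
    (rankWeight (fun M ↦ if M.IsSeriesParallel ∧ M.IsSimple then 1 else 0)) B rfl,
    Finset.sum_filter]
  · refine Finset.sum_congr rfl fun M hM ↦ ?_
    rw [mem_matroidsOn] at hM
    have hne : M.E.Nonempty := by rw [hM]; exact hB
    by_cases hc : M.IsConn
    · simp [rankWeight, hc, hc.isQuasiSeriesParallel_iff hne]
    · simp [rankWeight, hc, mt IsSeriesParallel.isConn hc]
  · intro f M
    simp only [rankWeight, map_isSeriesParallel_iff f.injective, eRank_map, map_isSimple_iff]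

/-- The generating function of labeled simple series-parallel matroids, for labels from a group
with `q` elements. -/
noncomputable def genLabeledSimpleSP (q : ℕ) : ℚ[X]⟦X⟧ :=
  PowerSeries.C (Polynomial.C (1 / (q : ℚ))) * PowerSeries.rescale (q : ℚ[X]) genSimpleSP

lemma constantCoeff_genLabeledSimpleSP (q : ℕ) :
    PowerSeries.constantCoeff (genLabeledSimpleSP q) = 0 := by
  rw [genLabeledSimpleSP, map_mul, ← PowerSeries.coeff_zero_eq_constantCoeff_apply
    (PowerSeries.rescale _ _), PowerSeries.coeff_rescale,
    PowerSeries.coeff_zero_eq_constantCoeff_apply, constantCoeff_genSimpleSP, mul_zero, mul_zero]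

open Classical in
lemma sum_isConn_eq_factorial_mul_coeff_genLabeledSimpleSP [Finite α] (G : Type*) [Group G]
    [Finite G] {B : Finset α} (hB : B.Nonempty) : ∑ M ∈ (matroidsOn B).filter IsConn,
      rankWeight
        (fun M ↦ if M.IsQuasiSeriesParallel ∧ M.IsSimple then labelCount G M else 0) M =
      (B.card ! : ℚ[X]) * PowerSeries.coeff B.card (genLabeledSimpleSP (Nat.card G)) := by
  have hq : (Nat.card G : ℚ) ≠ 0 := by exact_mod_cast Nat.card_pos.ne'
  have hq' : (Nat.card G : ℚ[X]) ≠ 0 := by exact_mod_cast Nat.card_pos.ne'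
  have h1 : (Nat.card G : ℚ[X]) * Polynomial.C (1 / (Nat.card G : ℚ)) = 1 := by
    rw [← Polynomial.C_eq_natCast, ← Polynomial.C_mul]
    change Polynomial.C ((Nat.card G : ℚ) * _) = 1
    rw [mul_one_div_cancel hq, Polynomial.C_1]
  -- After multiplication by the order q of `G`, each class count becomes q to the power `B.card`,
  -- and no division is needed.
  refine mul_left_cancel₀ hq' ?_
  calc _ = (Nat.card G : ℚ[X]) ^ B.card * ∑ M ∈ (matroidsOn B).filter IsConn,
        rankWeight (fun M ↦ if M.IsQuasiSeriesParallel ∧ M.IsSimple then 1 else 0) M := ?_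
    _ = ((Nat.card G : ℚ[X]) * Polynomial.C (1 / (Nat.card G : ℚ))) *
        ((Nat.card G : ℚ[X]) ^ B.card *
        ((B.card ! : ℚ[X]) * PowerSeries.coeff B.card genSimpleSP)) := by
      rw [sum_isConn_eq_factorial_mul_coeff_genSimpleSP hB, h1, one_mul]
    _ = _ := by
      rw [genLabeledSimpleSP, PowerSeries.coeff_C_mul, PowerSeries.coeff_rescale]
      ring
  rw [Finset.mul_sum, Finset.mul_sum]
  refine Finset.sum_congr rfl fun M hM ↦ ?_
  rw [Finset.mem_filter, mem_matroidsOn] at hM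
  have hne : M.E.Nonempty := by rw [hM.1]; exact hB
  have h2 := hM.2.card_mul_labelCount (G := G) hne
  rw [hM.1, ncard_coe_finset] at h2
  simp only [rankWeight]
  split_ifs
  · rw [← mul_assoc, ← Nat.cast_mul, h2]
    push_cast
    ring
  · simp

lemma isQuasiSeriesParallel_emptyOn : (emptyOn α).IsQuasiSeriesParallel := by
  rintro K ⟨e, he, -⟩
  exact he.elim

lemma isSimple_emptyOn : (emptyOn α).IsSimple := fun C hC ↦ by
  have h : C = ∅ := subset_empty_iff.1 hC.subset_ground
  exact (hC.nonempty.ne_empty h).elim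

open Classical in
/-- The series `A` counts quasi series-parallel matroids. -/
lemma sum_quasiSeriesParallel [Finite α] (E : Finset α) :
    ∑ M ∈ matroidsOn E, rankWeight (fun M ↦ if M.IsQuasiSeriesParallel then 1 else 0) M =
      (E.card ! : ℚ[X]) * PowerSeries.coeff E.card genA := by
  refine sum_matroidsOn_eq_factorial_mul_coeff _ (rankWeight_disjointSum fun M N h ↦ ?_) ?_ genC _
    (fun B hB ↦ sum_isConn_eq_factorial_mul_coeff_genC hB)
    (PowerSeries.constantCoeff_exp_subst constantCoeff_genC)
    (PowerSeries.derivative_exp_subst constantCoeff_genC) E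
  · simp only [disjointSum_isQuasiSeriesParallel_iff]
    split_ifs <;> simp_all
  · simp [rankWeight, isQuasiSeriesParallel_emptyOn]

open Classical in
lemma sum_simple_quasiSeriesParallel [Finite α] (E : Finset α) :
    ∑ M ∈ matroidsOn E,
      rankWeight (fun M ↦ if M.IsQuasiSeriesParallel ∧ M.IsSimple then 1 else 0) M =
      (E.card ! : ℚ[X]) * PowerSeries.coeff E.card
        ((PowerSeries.exp ℚ[X]).subst genSimpleSP) := by
  refine sum_matroidsOn_eq_factorial_mul_coeff _ (rankWeight_disjointSum fun M N h ↦ ?_) ?_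
    genSimpleSP _ (fun B hB ↦ sum_isConn_eq_factorial_mul_coeff_genSimpleSP hB)
    (PowerSeries.constantCoeff_exp_subst constantCoeff_genSimpleSP)
    (PowerSeries.derivative_exp_subst constantCoeff_genSimpleSP) E
  · simp only [disjointSum_isQuasiSeriesParallel_iff, disjointSum_isSimple_iff]
    split_ifs <;> simp_all
  · simp [rankWeight, isQuasiSeriesParallel_emptyOn, isSimple_emptyOn]

lemma labelCount_emptyOn (G : Type*) [Group G] : labelCount G (emptyOn α) = 1 := by
  have : IsEmpty (emptyOn α).E := by simp
  have : Unique ((emptyOn α).E → G) := Pi.uniqueOfIsEmpty _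
  rw [labelCount, Nat.card_eq_one_iff_unique]
  exact ⟨inferInstance, ⟨Quotient.mk _ default⟩⟩

open Classical in
lemma sum_labeled_quasiSeriesParallel [Finite α] (G : Type*) [Group G] [Finite G]
    (E : Finset α) : ∑ M ∈ matroidsOn E, rankWeight
        (fun M ↦ if M.IsQuasiSeriesParallel ∧ M.IsSimple then labelCount G M else 0) M =
      (E.card ! : ℚ[X]) * PowerSeries.coeff E.card
        ((PowerSeries.exp ℚ[X]).subst (genLabeledSimpleSP (Nat.card G))) := by
  refine sum_matroidsOn_eq_factorial_mul_coeff _ (rankWeight_disjointSum fun M N h ↦ ?_) ?_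
    (genLabeledSimpleSP (Nat.card G)) _
    (fun B hB ↦ sum_isConn_eq_factorial_mul_coeff_genLabeledSimpleSP G hB)
    (PowerSeries.constantCoeff_exp_subst (constantCoeff_genLabeledSimpleSP _))
    (PowerSeries.derivative_exp_subst (constantCoeff_genLabeledSimpleSP _)) E
  · simp only [disjointSum_isQuasiSeriesParallel_iff, disjointSum_isSimple_iff,
      labelCount_disjointSum]
    split_ifs <;> simp_all
  · simp [rankWeight, isQuasiSeriesParallel_emptyOn, isSimple_emptyOn, labelCount_emptyOn]

lemma _root_.factorial_cast_ne_zero (n : ℕ) : (n ! : ℚ[X]) ≠ 0 := by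
  exact_mod_cast n.factorial_ne_zero

/-- Simple quasi series-parallel matroids are sets of simple series-parallel matroids. -/
lemma genS_eq : genS = (PowerSeries.exp ℚ[X]).subst genSimpleSP := by
  ext1 n
  refine mul_left_cancel₀ (factorial_cast_ne_zero n) ?_
  rw [factorial_mul_coeff_genS, sum_simple_quasiSeriesParallel, Finset.card_fin]

lemma genSG_eq (G : Type*) [Group G] [Finite G] :
    genSG G = (PowerSeries.exp ℚ[X]).subst (genLabeledSimpleSP (Nat.card G)) := by
  ext1 n
  refine mul_left_cancel₀ (factorial_cast_ne_zero n) ?_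
  rw [factorial_mul_coeff_genSG, sum_labeled_quasiSeriesParallel, Finset.card_fin]

end Weight

end Matroid

namespace Matroid

open Set

/-! ### Passing from simple to all quasi series-parallel matroids -/

section Simplification

variable {α : Type*} {M N : Matroid α} {x u : α} {U : Set α}

lemma restrict_isSimple_iff (hU : U ⊆ M.E) :
    (M ↾ U).IsSimple ↔ ∀ C, M.IsCircuit C → C ⊆ U → 2 < C.encard := by
  simp only [IsSimple, restrict_isCircuit_iff hU, and_imp]

lemma isNonloop_of_restrict_isSimple (hU : U ⊆ M.E) (h : (M ↾ U).IsSimple) (hu : u ∈ U) :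
    M.IsNonloop u := by
  rw [← not_isLoop_iff (hU hu)]
  intro hl
  have := (restrict_isSimple_iff hU).1 h {u} hl.isCircuit (singleton_subset_iff.2 hu)
  rw [encard_singleton] at this
  exact absurd this (by norm_num)

lemma not_isCircuit_pair_of_restrict_isSimple {v : α} (hU : U ⊆ M.E) (h : (M ↾ U).IsSimple)
    (hu : u ∈ U) (hv : v ∈ U) : ¬ M.IsCircuit {u, v} := fun hc ↦ by
  have := (restrict_isSimple_iff hU).1 h _ hc (pair_subset hu hv)
  exact absurd this (not_lt.2 ((encard_insert_le _ _).trans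
    (by rw [encard_singleton]; norm_num)))

/-- If `M ↾ U` is simple, then either `x` is a loop, or `x` is parallel to an element of `U`, or
`M ↾ insert x U` is simple. -/
lemma restrict_insert_isSimple_iff (hU : U ⊆ M.E) (hx : x ∈ M.E) (h : (M ↾ U).IsSimple) :
    (M ↾ insert x U).IsSimple ↔ ¬ M.IsLoop x ∧ ∀ u ∈ U, ¬ M.IsCircuit {x, u} := by
  have hxU : insert x U ⊆ M.E := insert_subset hx hU
  constructor
  · intro h'
    exact ⟨(isNonloop_of_restrict_isSimple hxU h' (mem_insert _ _)).not_isLoop, fun u hu ↦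
      not_isCircuit_pair_of_restrict_isSimple hxU h' (mem_insert _ _) (mem_insert_of_mem _ hu)⟩
  · rintro ⟨hl, hp⟩
    rw [restrict_isSimple_iff hxU]
    intro C hC hCU
    by_cases hxC : x ∈ C
    · by_contra hcon
      rw [not_lt] at hcon
      have hCx : (C \ {x}).encard ≤ 1 := by
        rw [← encard_sdiff_singleton_add_one hxC] at hcon
        exact (ENat.add_le_add_iff_right ENat.one_ne_top).1 (by simpa [one_add_one_eq_two])
      rcases encard_le_one_iff_eq.1 hCx with h0 | ⟨u, hu⟩
      · have : C = {x} := by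
          rw [← insert_sdiff_self_of_mem hxC, h0]; simp
        exact hl (singleton_isCircuit.1 (this ▸ hC))
      · have hCxu : C = {x, u} := by
          rw [← insert_sdiff_self_of_mem hxC, hu]
        have huC : u ∈ C \ {x} := hu ▸ rfl
        exact hp u ((hCU huC.1).resolve_left huC.2) (hCxu ▸ hC)
    · exact (restrict_isSimple_iff hU).1 h C hC ((subset_insert_iff_of_notMem hxC).1 hCU)

open Classical in
-- Exactly one alternative holds: `x` is a loop, is parallel to a unique element of `U`, or keeps
-- the restriction simple. Uniqueness holds because two elements of `U` parallel to `x` would be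
-- parallel to each other.
lemma indicator_add_sum_add_indicator {R : Type*} [CommRing R] {U : Finset α}
    (hU : (U : Set α) ⊆ M.E) (hx : x ∈ M.E) (hxU : x ∉ U) (h : (M ↾ (U : Set α)).IsSimple) :
    (if M.IsLoop x then (1 : R) else 0) + ∑ u ∈ U, (if M.IsCircuit {x, u} then 1 else 0) +
      (if (M ↾ (insert x U : Set α)).IsSimple then 1 else 0) = 1 := by
  have hne : ∀ {u}, u ∈ U → x ≠ u := by rintro u hu rfl; exact hxU hu
  rw [restrict_insert_isSimple_iff hU hx h]
  by_cases hl : M.IsLoop x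
  · have : ∀ u ∈ U, (if M.IsCircuit {x, u} then (1 : R) else 0) = 0 := fun u hu ↦
      if_neg fun hc ↦ (hc.isNonloop_left (hne hu)).not_isLoop hl
    rw [Finset.sum_eq_zero this]
    simp [hl]
  by_cases hp : ∀ u ∈ U, ¬ M.IsCircuit {x, u}
  · have : ∀ u ∈ U, (if M.IsCircuit {x, u} then (1 : R) else 0) = 0 := fun u hu ↦
      if_neg (hp u hu)
    rw [Finset.sum_eq_zero this, if_neg hl, if_pos ⟨hl, hp⟩]
    simp
  · have hp' := hp
    push Not at hp
    obtain ⟨u, hu, hc⟩ := hp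
    rw [Finset.sum_eq_single_of_mem u hu, if_pos hc, if_neg hl, if_neg]
    · simp
    · exact fun h ↦ hp' h.2
    · intro v hv hvu
      refine if_neg fun hc' ↦ ?_
      rw [pair_comm] at hc
      exact not_isCircuit_pair_of_restrict_isSimple hU h hu hv
        (hc.pair_trans hc' (hne hu).symm (hne hv) hvu.symm)

lemma delete_restrict_of_notMem (hU : U ⊆ M.E) (hx : x ∉ U) : (M ＼ {x}) ↾ U = M ↾ U := by
  rw [delete_eq_restrict, restrict_restrict_eq]
  exact fun y hy ↦ ⟨hU hy, by rintro rfl; exact hx hy⟩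

variable [Finite α]

open Classical in
/-- The quasi series-parallel matroids on `E` whose restriction to `U` is simple, counted by
rank. -/
noncomputable def partialSimpleSum (U E : Finset α) : ℚ[X] :=
  ∑ M ∈ matroidsOn E, rankWeight
    (fun M ↦ if M.IsQuasiSeriesParallel ∧ (M ↾ (U : Set α)).IsSimple then 1 else 0) M

open Classical in
lemma partialSimpleSum_eq_sum_filter (U E : Finset α) : partialSimpleSum U E =
    ∑ M ∈ (matroidsOn E).filter
      (fun M ↦ M.IsQuasiSeriesParallel ∧ (M ↾ (U : Set α)).IsSimple),
      (Polynomial.X : ℚ[X]) ^ M.eRank.toNat := by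
  rw [Finset.sum_filter]
  refine Finset.sum_congr rfl fun M _ ↦ ?_
  rw [rankWeight]
  split_ifs <;> simp

open Classical in
lemma sum_filter_isLoop {U E : Finset α} (hUE : U ⊆ E) (hx : x ∉ E) :
    ∑ M ∈ ((matroidsOn (insert x E)).filter
      (fun M ↦ M.IsQuasiSeriesParallel ∧ (M ↾ (U : Set α)).IsSimple)).filter
        (fun M ↦ M.IsLoop x), (Polynomial.X : ℚ[X]) ^ M.eRank.toNat = partialSimpleSum U E := by
  rw [partialSimpleSum_eq_sum_filter]
  have hxU : x ∉ (U : Set α) := fun h ↦ hx (hUE h)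
  have hUE' : (U : Set α) ⊆ ↑(insert x E) := by
    exact_mod_cast hUE.trans (Finset.subset_insert _ _)
  -- Restricting to a set larger than the ground set adds the new element as a loop.
  refine Finset.sum_nbij' (fun M ↦ M ＼ {x}) (fun N ↦ N ↾ insert x N.E) ?_ ?_ ?_ ?_ ?_
  · intro M hM
    simp only [Finset.mem_filter, mem_matroidsOn] at hM ⊢
    obtain ⟨⟨hE, hq, hs⟩, hl⟩ := hM
    rw [hl.isQuasiSeriesParallel_delete_iff, delete_restrict_of_notMem (hE ▸ hUE') hxU]
    refine ⟨?_, hq, hs⟩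
    rw [delete_ground, hE]
    simp [hx]
  · intro N hN
    simp only [Finset.mem_filter, mem_matroidsOn] at hN ⊢
    obtain ⟨hE, hq, hs⟩ := hN
    have hxN : x ∉ N.E := by simpa [hE] using hx
    have hl := restrict_insert_isLoop hxN
    refine ⟨⟨?_, ?_, ?_⟩, hl⟩
    · simp [hE]
    · rwa [← hl.isQuasiSeriesParallel_delete_iff, restrict_insert_delete hxN]
    · rw [restrict_restrict_eq]
      · exact hs
      · rw [hE]
        exact_mod_cast hUE'
  · intro M hM
    simp only [Finset.mem_filter, mem_matroidsOn] at hM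
    have hxE : x ∈ M.E := hM.2.mem_ground
    rw [delete_ground, insert_sdiff_self_of_mem hxE]
    exact hM.2.restrict_insert_delete
  · intro N hN
    simp only [Finset.mem_filter, mem_matroidsOn] at hN
    exact restrict_insert_delete (by simpa [hN.1] using hx)
  · intro M hM
    simp only [Finset.mem_filter, mem_matroidsOn] at hM
    rw [hM.2.eRank_delete_eq]

open Classical in
-- Deleting `x` is a rank-preserving bijection. Simplicity on `U` makes `u` a nonloop, so a parallel
-- copy of it can be added back.
lemma sum_filter_isCircuit_pair {U E : Finset α} (hUE : U ⊆ E) (hx : x ∉ E) (hu : u ∈ U) :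
    ∑ M ∈ ((matroidsOn (insert x E)).filter
      (fun M ↦ M.IsQuasiSeriesParallel ∧ (M ↾ (U : Set α)).IsSimple)).filter
        (fun M ↦ M.IsCircuit {x, u}), (Polynomial.X : ℚ[X]) ^ M.eRank.toNat =
      partialSimpleSum U E := by
  rw [partialSimpleSum_eq_sum_filter]
  have hxU : x ∉ (U : Set α) := fun h ↦ hx (hUE h)
  have hxu : x ≠ u := by rintro rfl; exact hxU hu
  have hUE' : (U : Set α) ⊆ ↑(insert x E) := by
    exact_mod_cast hUE.trans (Finset.subset_insert _ _)
  refine Finset.sum_nbij' (fun M ↦ M ＼ {x}) (fun N ↦ N.comap (Function.update id x u))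
    ?_ ?_ ?_ ?_ ?_
  · intro M hM
    simp only [Finset.mem_filter, mem_matroidsOn] at hM ⊢
    obtain ⟨⟨hE, hq, hs⟩, hc⟩ := hM
    rw [hc.isQuasiSeriesParallel_delete_iff hxu, delete_restrict_of_notMem (hE ▸ hUE') hxU]
    refine ⟨?_, hq, hs⟩
    rw [delete_ground, hE]
    simp [hx]
  · intro N hN
    simp only [Finset.mem_filter, mem_matroidsOn] at hN ⊢
    obtain ⟨hE, hq, hs⟩ := hN
    have hxN : x ∉ N.E := by simpa [hE] using hx
    have hUN : (U : Set α) ⊆ N.E := by rw [hE]; exact_mod_cast hUE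
    have hun := isNonloop_of_restrict_isSimple hUN hs hu
    have hc := comap_update_isCircuit hxN hun
    have hg := comap_update_ground hxN hun.mem_ground
    have hd := comap_update_delete hxN hun.mem_ground
    refine ⟨⟨?_, ?_, ?_⟩, hc⟩
    · rw [hg]
      simp [hE]
    · rwa [← hc.isQuasiSeriesParallel_delete_iff hxu, hd]
    · rwa [← delete_restrict_of_notMem (hg ▸ hUN.trans (subset_insert _ _)) hxU, hd]
  · intro M hM
    simp only [Finset.mem_filter, mem_matroidsOn] at hM
    exact hM.2.comap_delete_eq hxu
  · intro N hN
    simp only [Finset.mem_filter, mem_matroidsOn] at hN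
    refine comap_update_delete (by simpa [hN.1] using hx) ?_
    rw [hN.1]
    exact_mod_cast hUE hu
  · intro M hM
    simp only [Finset.mem_filter, mem_matroidsOn] at hM
    rw [hM.2.eRank_delete_eq hxu]

open Classical in
-- The factor `U.card + 1` counts the ways for `x` to be redundant over `U`: as a loop or as a copy
-- of one of its elements.
lemma partialSimpleSum_insert {U E : Finset α} (hUE : U ⊆ E) (hx : x ∉ E) :
    partialSimpleSum U (insert x E) =
      (U.card + 1) * partialSimpleSum U E + partialSimpleSum (insert x U) (insert x E) := by
  have hxU : x ∉ U := fun h ↦ hx (hUE h)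
  have hUE' : (U : Set α) ⊆ ↑(insert x E) := by
    exact_mod_cast hUE.trans (Finset.subset_insert _ _)
  have h3 : ∑ M ∈ ((matroidsOn (insert x E)).filter
      (fun M ↦ M.IsQuasiSeriesParallel ∧ (M ↾ (U : Set α)).IsSimple)).filter
        (fun M ↦ (M ↾ (insert x U : Set α)).IsSimple), (Polynomial.X : ℚ[X]) ^ M.eRank.toNat =
      partialSimpleSum (insert x U) (insert x E) := by
    rw [partialSimpleSum_eq_sum_filter, Finset.filter_filter]
    refine Finset.sum_congr (Finset.filter_congr fun M hM ↦ ?_) fun _ _ ↦ rfl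
    rw [mem_matroidsOn] at hM
    rw [Finset.coe_insert, and_assoc, and_congr_right_iff, and_iff_right_iff_imp]
    intro _ hs
    have hU : (U : Set α) ⊆ M.E := hM ▸ hUE'
    have hU' : insert x (U : Set α) ⊆ M.E := insert_subset (by simp [hM]) hU
    rw [restrict_isSimple_iff hU'] at hs
    rw [restrict_isSimple_iff hU]
    exact fun C hC hCU ↦ hs C hC (hCU.trans (subset_insert _ _))
  have h4 : ((U.card : ℚ[X]) + 1) * partialSimpleSum U E =
      partialSimpleSum U E + ∑ u ∈ U, partialSimpleSum U E := by
    rw [Finset.sum_const, nsmul_eq_mul]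
    ring
  rw [h4, ← h3, Finset.sum_congr rfl (fun u hu ↦ (sum_filter_isCircuit_pair hUE hx hu).symm),
    ← sum_filter_isLoop hUE hx,
    partialSimpleSum_eq_sum_filter]
  simp only [Finset.sum_filter _ (s := Finset.filter _ _)]
  rw [Finset.sum_comm, ← Finset.sum_add_distrib, ← Finset.sum_add_distrib]
  refine Finset.sum_congr rfl fun M hM ↦ ?_
  rw [Finset.mem_filter, mem_matroidsOn] at hM
  have h1 := indicator_add_sum_add_indicator (R := ℚ[X]) (M := M) (x := x) (hM.1 ▸ hUE')
    (by simp [hM.1]) hxU hM.2.2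
  calc _ = 1 * (Polynomial.X : ℚ[X]) ^ M.eRank.toNat := (one_mul _).symm
    _ = _ := by
      rw [← h1, add_mul, add_mul, Finset.sum_mul]
      simp only [ite_mul, one_mul, zero_mul]

open PowerSeries in
-- Interpolates between `U = E`, where only simple matroids count and the constant coefficient of
-- `expIterSeries` appears, and `U = ∅`, where there is no simplicity condition. The induction is on
-- the number of elements of `E` outside `U`.
lemma partialSimpleSum_eq (U E : Finset α) (hUE : U ⊆ E) : partialSimpleSum U E =
    ((E.card - U.card) ! : ℚ[X]) * coeff (E.card - U.card) (expIterSeries genS U.card) := by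
  classical
  induction hn : E.card - U.card generalizing U E with
  | zero =>
    obtain rfl : U = E := Finset.eq_of_subset_of_card_le hUE (Nat.sub_eq_zero_iff_le.1 hn)
    rw [coeff_zero_eq_constantCoeff_apply, constantCoeff_expIterSeries, Nat.factorial_zero,
      Nat.cast_one, one_mul, genS_eq, ← sum_simple_quasiSeriesParallel, partialSimpleSum]
    refine Finset.sum_congr rfl fun M hM ↦ ?_
    rw [mem_matroidsOn] at hM
    simp only [rankWeight]
    rw [← hM, restrict_ground_eq_self]
  | succ n ih =>
    have hne : (E \ U).Nonempty := by
      rw [← Finset.card_pos, Finset.card_sdiff_of_subset hUE]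
      omega
    obtain ⟨x, hx⟩ := hne
    rw [Finset.mem_sdiff] at hx
    obtain ⟨E, rfl, hxE⟩ : ∃ E', E = insert x E' ∧ x ∉ E' :=
      ⟨E.erase x, by simp [hx.1], by simp⟩
    have hUE' : U ⊆ E := (Finset.subset_insert_iff_of_notMem hx.2).1 hUE
    have hc1 := Finset.card_insert_of_notMem hxE
    have hc2 := Finset.card_insert_of_notMem hx.2
    rw [partialSimpleSum_insert hUE' hxE, ih U E hUE' (by omega),
      ih (insert x U) (insert x E) (Finset.insert_subset_insert _ hUE') (by omega), hc2]
    -- Up to the factor `n !`, this coefficient is the recursion just applied to the sums.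
    have h := congrArg (coeff n) (derivative_expIterSeries genS U.card)
    rw [coeff_derivative, map_add] at h
    have h' : coeff n (((U.card : ℚ[X]⟦X⟧) + 1) * expIterSeries genS U.card) =
        ((U.card : ℚ[X]) + 1) * coeff n (expIterSeries genS U.card) := by
      rw [← coeff_C_mul]
      simp
    rw [h'] at h
    rw [Nat.factorial_succ]
    push_cast
    linear_combination (-(n ! : ℚ[X])) * h

open PowerSeries in
/-- Quasi series-parallel matroids are obtained from simple ones by replacing each element by a
parallel class and adding loops. -/
lemma genA_eq : genA = exp ℚ[X] * genS.subst (exp ℚ[X] - 1) := by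
  classical
  ext1 n
  refine mul_left_cancel₀ (factorial_cast_ne_zero n) ?_
  have h := partialSimpleSum_eq (∅ : Finset (Fin n)) Finset.univ (by simp)
  have h2 := sum_quasiSeriesParallel (Finset.univ : Finset (Fin n))
  simp only [Finset.card_empty, Finset.card_univ, Fintype.card_fin, Nat.sub_zero] at h h2
  rw [← h2]
  have h3 : expIterSeries genS 0 = exp ℚ[X] * genS.subst (exp ℚ[X] - 1) := by
    simp [expIterSeries]
  rw [← h3, ← h, partialSimpleSum]
  refine Finset.sum_congr rfl fun M _ ↦ ?_
  simp [rankWeight, isSimple_emptyOn]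

end Simplification

end Matroid

/-! ### Conclusion: the logarithmic substitution and the q-th root -/

open PowerSeries in
-- In A = eˣ · S(eˣ - 1), putting log(1 + qx) for x turns the factor eˣ into 1 + qx, which cancels,
-- and the argument eˣ - 1 into qx.
lemma invOfUnit_mul_genA_subst (q : ℕ) :
    invOfUnit (1 + (q : ℚ[X]⟦X⟧) * X) 1 * genA.subst (logOf (1 + (q : ℚ[X]⟦X⟧) * X)) =
      rescale (q : ℚ[X]) genS := by
  have hf : constantCoeff (1 + (q : ℚ[X]⟦X⟧) * X) = 1 := by simp
  have hL : HasSubst (logOf (1 + (q : ℚ[X]⟦X⟧) * X)) :=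
    HasSubst.of_constantCoeff_zero' (constantCoeff_logOf hf)
  rw [Matroid.genA_eq, subst_mul hL, exp_subst_logOf hf, ← mul_assoc,
    invOfUnit_mul _ _ (by simp), one_mul, subst_comp_subst_apply HasSubst.exp_sub_one hL,
    subst_sub hL, exp_subst_logOf hf, one_subst hL, add_sub_cancel_left, rescale_eq_subst]
  congr 1
  rw [smul_eq_C_mul, map_natCast]

open PowerSeries in
lemma derivative_rescale {A : Type*} [CommRing A] (a : A) (f : A⟦X⟧) :
    derivative A (rescale a f) = C a * rescale a (derivative A f) := by
  ext n
  rw [coeff_derivative, coeff_rescale, coeff_C_mul, coeff_rescale, coeff_derivative]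
  ring

open PowerSeries in
lemma derivative_C_mul {A : Type*} [CommRing A] (a : A) (f : A⟦X⟧) :
    derivative A (C a * f) = C a * derivative A f := by
  ext n
  rw [coeff_derivative, coeff_C_mul, coeff_C_mul, coeff_derivative]
  ring

open PowerSeries in
-- With f = S(qx) = exp(D(qx)), both exp(D(qx)/q) and f^(1/q) solve f · u' = (1/q) · f' · u and have
-- constant coefficient 1.
lemma genSG_eq_ratPow (G : Type*) [Group G] [Finite G] :
    genSG G = ratPow (rescale (Nat.card G : ℚ[X]) genS) (1 / (Nat.card G : ℚ)) := by
  have h0 := Matroid.constantCoeff_genSimpleSP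
  have hf : constantCoeff (rescale (Nat.card G : ℚ[X]) genS) = 1 := by
    rw [← coeff_zero_eq_constantCoeff_apply, coeff_rescale, coeff_zero_eq_constantCoeff_apply,
      Matroid.genS_eq, constantCoeff_exp_subst h0, pow_zero, one_mul]
  have hD := Matroid.constantCoeff_genLabeledSimpleSP (Nat.card G)
  refine eq_of_mul_derivative_eq_mul hf ?_ (mul_derivative_ratPow hf _) ?_
  · have h1 : rescale (Nat.card G : ℚ[X]) (derivative ℚ[X] genS) =
        rescale (Nat.card G : ℚ[X]) (derivative ℚ[X] Matroid.genSimpleSP) *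
          rescale (Nat.card G : ℚ[X]) genS := by
      rw [Matroid.genS_eq, derivative_exp_subst h0, map_mul]
    rw [Matroid.genSG_eq, derivative_exp_subst hD, Matroid.genLabeledSimpleSP,
      derivative_C_mul, derivative_rescale, derivative_rescale, h1]
    ring
  · rw [Matroid.genSG_eq, constantCoeff_exp_subst hD, constantCoeff_ratPow hf]

/-- `PowerSeries.logOf f` is `log f`; `PowerSeries.invOfUnit f 1` is `1 / f` for a power series `f`
with constant coefficient `1`; `f.subst g` is `f(g(x), y)`, and `rescale q f` is `f(q x, y)`. -/
theorem proposition3p3 (G : Type*) [Group G] [Finite G] (q : ℕ) (hq : q = Nat.card G) :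
    genSG G =
      ratPow
        (PowerSeries.invOfUnit (1 + (q : ℚ[X]⟦X⟧) * PowerSeries.X) 1 *
          genA.subst (PowerSeries.logOf (1 + (q : ℚ[X]⟦X⟧) * PowerSeries.X)))
        (1 / (q : ℚ)) ∧
    genSG G = ratPow (PowerSeries.rescale (q : ℚ[X]) genS) (1 / (q : ℚ)) := by
  subst hq
  rw [invOfUnit_mul_genA_subst]
  exact ⟨genSG_eq_ratPow G, genSG_eq_ratPow G⟩
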